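/- Let $\mathbb T^1=\mathbb R/\mathbb Z$, $\mathbb I=[0,1]$, $\mathbb A=\mathbb T^1\times\mathbb I$, and let $\omega$ be irrational. A quasiperiodically forced (qpf) increasing interval map over the rotation by $\omega$ is a continuous map $f:\mathbb A\to\mathbb A$, $f(\theta,x)=(\theta+\omega,f_\theta(x))$, all of whose fibre maps $f_\theta:\mathbb I\to\mathbb I$ are strictly increasing. For $A\subseteq\mathbb A$ put $A_\theta=\{x:(\theta,x)\in A\}$; $A$ is pinched if some $A_\theta$ has exactly one point. A minimal set $M$ is a non-empty closed invariant set with no proper non-empty closed invariant subset. It is filled-in if $M=\{(\theta,x): \inf M_\theta\le x\le \sup M_\theta\}$. It is almost periodic if, for $g=f|_M$ and every $\varepsilon>0$, the set $\{n\in\mathbb Z: d(g^n,\mathrm{Id}_M)<\varepsilon\}$ has uniformly bounded gaps in $\mathbb Z$, where $d$ is the uniform distance, and almost automorphic if there is $x\in M$ such that, for every sequence of integers $n_k$, $g^{n_k}(x)\to y$ implies $g^{-n_k}(y)\to x$. A Denjoy homeomorphism is an orientation-preserving homeomorphism of $\mathbb T^1$ with irrational rotation number and a wandering open interval (one whose iterates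 are pairwise disjoint). (a) Let $f$ be a qpf increasing interval map over the rotation by $\omega$ and let $\gamma:\mathbb T^1\to\mathrm{int}\,\mathbb I=(0,1)$ be continuous, with $f$-invariant graph $\Gamma=\{(\theta,\gamma(\theta)):\theta\in\mathbb T^1\}$. Then there exist a map $\hat f:\mathbb A\to\mathbb A$ and a continuous surjection $h:\mathbb A\to\mathbb A$, $h(\theta,x)=(\theta,h_\theta(x))$, with $h\circ\hat f=f\circ h$, such that: 1. $\hat f$ is a qpf increasing interval map over the rotation by $\omega$; 2. all $h_\theta$ are non-decreasing; 3. $h$ is injective on the complement of $h^{-1}(\Gamma)$; 4. for countably infinitely many points of $\Gamma$ the preimage under $h$ is a non-degenerate vertical segment, and for all other points of $\Gamma$ it is a singleton; 5. $h^{-1}(\Gamma)$ contains no graph of a continuous function $\eta:\mathbb T^1\to\mathbb I$; 6. $h^{-1}(\Gamma)$ is pinched; 7. $h^{-1}(\Gamma)$ is homeomorphic to $\mathbb T^1$, by a homeomorphism which conjugates $\hat f|_{h^{-1}(\Gamma)}$ to a Denjoy homeomorphism; 8. $h^{-1}(\Gamma)$ contains exactly one minimal set of $\hat f$, and this set is almost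 automorphic, not almost periodic and not filled-in. (b) In particular, there is a qpf increasing interval map over the rotation by $\omega$ which has an almost automorphic minimal set that is not filled-in. -/

import Mathlib

open Set Filter Topology
open scoped unitInterval

namespace ForcedInterval

section Dynamics

variable {X : Type*}

/-- Minimal sets: non-empty closed invariant sets without a proper non-empty closed invariant
subset. (On a compact space minimality forces `f '' M = M`.) -/
def IsMinimalSet [TopologicalSpace X] (f : X → X) (M : Set X) : Prop :=
  M.Nonempty ∧ IsClosed M ∧ MapsTo f M M ∧
    ∀ K : Set X, K ⊆ M → K.Nonempty → IsClosed K → MapsTo f K K → K = M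

/-- A set of integers is syndetic if its gaps are uniformly bounded. -/
def Syndetic (A : Set ℤ) : Prop :=
  ∃ L : ℕ, ∀ m : ℤ, ∃ n ∈ A, m ≤ n ∧ n ≤ m + L

/-- Almost periodic homeomorphism (of a compact metric space, where the uniform distance of
`g ^ n` to the identity is attained): the set of `n` such that `g ^ n` is uniformly `ε`-close to
the identity is syndetic for every `ε > 0`. -/
def AlmostPeriodic [MetricSpace X] (g : X ≃ₜ X) : Prop :=
  ∀ ε : ℝ, 0 < ε → Syndetic {n : ℤ | ∀ x : X, dist ((g ^ n) x) x < ε}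

/-- Almost automorphic homeomorphism: there is a point `x` such that `g ^ (n k) x → y` always
implies `g ^ (-n k) y → x`. -/
def AlmostAutomorphic [MetricSpace X] (g : X ≃ₜ X) : Prop :=
  ∃ x : X, ∀ (n : ℕ → ℤ) (y : X),
    Tendsto (fun k => (g ^ n k) x) atTop (𝓝 y) →
      Tendsto (fun k => (g ^ (-n k)) y) atTop (𝓝 x)

/-- `f` restricts to a homeomorphism of `M` which is almost periodic. -/
def AlmostPeriodicOn [MetricSpace X] (f : X → X) (M : Set X) : Prop :=
  ∃ g : M ≃ₜ M, (∀ x : M, (g x : X) = f x) ∧ AlmostPeriodic g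

/-- `f` restricts to a homeomorphism of `M` which is almost automorphic. -/
def AlmostAutomorphicOn [MetricSpace X] (f : X → X) (M : Set X) : Prop :=
  ∃ g : M ≃ₜ M, (∀ x : M, (g x : X) = f x) ∧ AlmostAutomorphic g

/-- `h` is a factor map (semiconjugacy) from `F` to `f`; equivalently, via `h`, `F` is a
topological extension of `f`. -/
def IsFactorMap {Y : Type*} [TopologicalSpace X] [TopologicalSpace Y]
    (h : X → Y) (F : X → X) (f : Y → Y) : Prop :=
  Continuous h ∧ Function.Surjective h ∧ Function.Semiconj h F f

end Dynamics

section Circle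

/-- A homeomorphism `g` of the circle `ℝ / ℤ` of Denjoy type: it has a lift to the real line which
is increasing and of degree one and whose translation number is irrational (the rotation number of
`g` being the class of this number modulo `1`), and there is an open interval all of whose iterates
are pairwise disjoint. -/
def IsDenjoyHomeo (g : UnitAddCircle ≃ₜ UnitAddCircle) : Prop :=
  (∃ F : CircleDeg1Lift, Continuous F ∧
    (∀ x : ℝ, ((F x : ℝ) : UnitAddCircle) = g (x : UnitAddCircle)) ∧
    Irrational F.translationNumber) ∧
  ∃ a b : ℝ, a < b ∧ ∀ m n : ℤ, m ≠ n →
    Disjoint ((g ^ m) '' ((fun x : ℝ => (x : UnitAddCircle)) '' Ioo a b))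
      ((g ^ n) '' ((fun x : ℝ => (x : UnitAddCircle)) '' Ioo a b))

end Circle

section Forced

variable {Θ : Type*}

/-- The fibre `A_θ` of a subset of the product. -/
def fibre (A : Set (Θ × I)) (θ : Θ) : Set I := {x | (θ, x) ∈ A}

/-- The graph of a function on the base. -/
def graph (γ : Θ → I) : Set (Θ × I) := range fun θ => (θ, γ θ)

/-- `f` is an `α`-forced increasing interval map, with interval `[0,1]`. -/
def IsForcedIncreasing [TopologicalSpace Θ] (α : Θ → Θ) (f : Θ × I → Θ × I) : Prop :=
  Continuous f ∧ (∀ p, (f p).1 = α p.1) ∧ ∀ θ, StrictMono fun x : I => (f (θ, x)).2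

/-- Some fibre of `A` consists of exactly one point. -/
def IsPinched (A : Set (Θ × I)) : Prop := ∃ θ, (fibre A θ).encard = 1

/-- A non-degenerate compact segment inside one fibre. -/
def IsVerticalSegment (S : Set (Θ × I)) : Prop :=
  ∃ (θ : Θ) (a b : I), a < b ∧ S = {θ} ×ˢ Icc a b

/-- `M` equals the set of all `(θ, x)` with `inf M_θ ≤ x ≤ sup M_θ`. -/
def IsFilledIn (M : Set (Θ × I)) : Prop :=
  M = {p : Θ × I | p.2 ∈ Icc (sInf (fibre M p.1)) (sSup (fibre M p.1))}

end Forced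

end ForcedInterval

/-! The orbit points z_n = (nω, γ(nω)) on the invariant curve are blown up simultaneously. The local
model `pointBlowUp` attaches to each point of the annulus a number v in [0,1]. Away from (0, γ 0) it
is unique and non-decreasing along fibres; at (0, γ 0) it is arbitrary. On the curve off that point
it is the fractional part of -θ, so it tends to 1 on one side of θ = 0 and to 0 on the other.

Pulling this model back by the inverse iterates and recording all values at once gives the closed
set `blowUp` of pairs (p, (v_n)), on which `f` acts together with the index shift. Its fibre over p
is a point, except over z_n, where exactly the n-th coordinate is free and the fibre is an arc. Over
each θ the blow-up is connected and totally ordered by the product order (`blowUp_total`), so the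
map (y, v) ↦ y + y(1-y) Σ w_n v_n, strictly increasing on it, flattens it onto the interval. This
makes `blowUp` homeomorphic to the annulus (`flattenHomeo`); the transported dynamics is the
extension and the projection is the factor map.

On the curve, v_n is a sawtooth jumping at nω, which excludes a continuous section. Off the orbit
the fibres of the blown-up curve are singletons. A closed invariant subset projects onto the circle
by density of the rotation orbit, so it contains all these singletons; hence their closure is the
only minimal set. A singleton fibre over the rotation gives almost automorphy. Both ends of the
segment over z_0 lie in the minimal set, but every non-zero iterate gives them the same coordinate
v_0, so no such iterate is uniformly close to the identity. The interior of that segment is missing,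
so the set is not filled-in.

Finally θ + Σ w_n v_n parametrizes the blown-up curve by a circle. The lifted sum is strictly
increasing because each v_n + x is non-decreasing along the lift and the weights sum to at most 1/2
(`add_height_lt`). Collapsing the segments semiconjugates the induced circle map to the rotation,
and the segment over z_0 provides the wandering interval. -/

namespace ForcedInterval

/-! ### The local model: blowing up a single point of the curve -/

/-- Graph relation of the function whose value at `x ∈ [0, 1]`, `s > 0` is
`1 - min x ((1 - x) / s)` and at `s < 0` is `min (1 - x) (x / |s|)`. -/
def CornerRel (x s v : ℝ) : Prop :=
  (0 ≤ s ∧ 1 - v ≤ x ∧ s * (1 - v) ≤ 1 - x ∧ (x - 1 + v) * (1 - x - s * (1 - v)) = 0) ∨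
  (s ≤ 0 ∧ v ≤ 1 - x ∧ -s * v ≤ x ∧ (1 - x - v) * (x + s * v) = 0)

/-- Both branches take the value 1 - x at s = 0, and each is a minimum or maximum of functions
monotone in s. With s = s' this also yields uniqueness of v. -/
lemma CornerRel.le_of_le {x s s' v v' : ℝ} (hx0 : 0 < x) (hx1 : x < 1) (hs : s ≤ s')
    (hv0 : 0 ≤ v) (hv1' : v' ≤ 1)
    (h : CornerRel x s v) (h' : CornerRel x s' v') : v ≤ v' := by
  rcases h with ⟨h1, h2, h3, h4⟩ | ⟨h1, h2, h3, h4⟩ <;>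
    rcases h' with ⟨h1', h2', h3', h4'⟩ | ⟨h1', h2', h3', h4'⟩
  · rcases mul_eq_zero.1 h4 with h | h
    · linarith
    · by_contra! hlt
      have : 0 < s := by
        by_contra! h0
        nlinarith
      nlinarith
  · have e1 : s = 0 := le_antisymm (by linarith) h1
    have e2 : s' = 0 := le_antisymm h1' (by linarith)
    subst e1 e2
    rcases mul_eq_zero.1 h4 with h | h <;> rcases mul_eq_zero.1 h4' with h' | h' <;> linarith
  · linarith
  · rcases mul_eq_zero.1 h4' with h | h
    · linarith
    · by_contra! hlt
      have : s' < 0 := by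
        by_contra! h0
        nlinarith
      nlinarith

/-- The ends x = 0 and x = 1 are one point of the circle, so the relation has to agree there. It
does: only the sign of s matters. -/
lemma CornerRel.eq_one_of_pos {x s v : ℝ} (hx : x = 0 ∨ x = 1) (hs : 0 < s) (hv1 : v ≤ 1)
    (h : CornerRel x s v) : v = 1 := by
  rcases h with ⟨h1, h2, h3, h4⟩ | ⟨h1, h2, h3, h4⟩
  · rcases hx with rfl | rfl
    · linarith
    · nlinarith
  · linarith

lemma CornerRel.eq_zero_of_neg {x s v : ℝ} (hx : x = 0 ∨ x = 1) (hs : s < 0) (hv0 : 0 ≤ v)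
    (h : CornerRel x s v) : v = 0 := by
  rcases h with ⟨h1, h2, h3, h4⟩ | ⟨h1, h2, h3, h4⟩
  · linarith
  · rcases hx with rfl | rfl
    · nlinarith
    · linarith

lemma CornerRel.exists {x : ℝ} (hx : x ∈ Icc (0 : ℝ) 1) (s : ℝ) :
    ∃ v ∈ Icc (0 : ℝ) 1, CornerRel x s v := by
  obtain ⟨h0, h1⟩ := hx
  rcases le_or_gt s 0 with hs | hs
  · by_cases hc : -s * (1 - x) ≤ x
    · exact ⟨1 - x, ⟨by linarith, by linarith⟩, Or.inr ⟨hs, le_rfl, hc, by ring⟩⟩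
    · push Not at hc
      have hs' : 0 < -s := by
        by_contra! h
        nlinarith
      have e : -s * (x / -s) = x := by rw [← mul_div_assoc, mul_div_cancel_left₀ _ hs'.ne']
      have hle : x / -s ≤ 1 - x := by
        rw [div_le_iff₀ hs']; linarith
      refine ⟨x / -s, ⟨by positivity, by linarith⟩, Or.inr ⟨hs, hle, e.le, ?_⟩⟩
      have : x + s * (x / -s) = 0 := by linarith
      rw [this, mul_zero]
  · by_cases hc : s * x ≤ 1 - x
    · exact ⟨1 - x, ⟨by linarith, by linarith⟩, Or.inl ⟨hs.le, by linarith, by linarith, by ring⟩⟩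
    · push Not at hc
      have e : s * ((1 - x) / s) = 1 - x := by field_simp
      have hle : (1 - x) / s ≤ x := by
        rw [div_le_iff₀ hs]; linarith
      have h0' : 0 ≤ (1 - x) / s := div_nonneg (by linarith) hs.le
      refine ⟨1 - (1 - x) / s, ⟨by linarith, by linarith⟩,
        Or.inl ⟨hs.le, by linarith, by linarith, ?_⟩⟩
      have : 1 - x - s * (1 - (1 - (1 - x) / s)) = 0 := by linarith
      rw [this, mul_zero]

/-- The slice s = 0 is the curve itself: the sawtooth 1 - x, completed by a full segment at the
jump. -/
lemma CornerRel.zero_iff {x v : ℝ} (hx : x ∈ Icc (0 : ℝ) 1) (hv : v ∈ Icc (0 : ℝ) 1) :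
    CornerRel x 0 v ↔ x = 0 ∨ x = 1 ∨ v = 1 - x := by
  obtain ⟨h0, h1⟩ := hx
  obtain ⟨g0, g1⟩ := hv
  constructor
  · rintro (⟨-, h2, h3, h4⟩ | ⟨-, h2, h3, h4⟩)
    · rcases mul_eq_zero.1 h4 with h | h
      · exact Or.inr (Or.inr (by linarith))
      · exact Or.inr (Or.inl (by linarith))
    · rcases mul_eq_zero.1 h4 with h | h
      · exact Or.inr (Or.inr (by linarith))
      · exact Or.inl (by linarith)
  · rintro (rfl | rfl | rfl)
    · exact Or.inr ⟨le_rfl, by linarith, by linarith, by ring⟩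
    · exact Or.inl ⟨le_rfl, by linarith, by linarith, by ring⟩
    · exact Or.inl ⟨le_rfl, by linarith, by linarith, by ring⟩

lemma isClosed_cornerRel : IsClosed {q : ℝ × ℝ × ℝ | CornerRel q.1 q.2.1 q.2.2} := by
  simp only [CornerRel, ofPred_or, ofPred_and]
  refine IsClosed.union ?_ ?_ <;>
    exact (isClosed_le (by fun_prop) (by fun_prop)).inter
      ((isClosed_le (by fun_prop) (by fun_prop)).inter
        ((isClosed_le (by fun_prop) (by fun_prop)).inter
          (isClosed_eq (by fun_prop) (by fun_prop))))

/-- The blow-up of the annulus at the point `(0, γ 0)`, as a closed relation. -/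
def pointBlowUp (γ : UnitAddCircle → I) : Set ((UnitAddCircle × I) × I) :=
  {z | ∃ x ∈ Icc (0 : ℝ) 1, (x : UnitAddCircle) = z.1.1 ∧
    CornerRel x ((z.1.2 : ℝ) - γ z.1.1) z.2}

lemma isClosed_pointBlowUp {γ : UnitAddCircle → I} (hγ : Continuous γ) :
    IsClosed (pointBlowUp γ) := by
  let S : Set (I × I × I) := {q | CornerRel q.1 ((q.2.1 : ℝ) - γ ((q.1 : ℝ) : UnitAddCircle)) q.2.2}
  have hS : IsClosed S := by
    refine isClosed_cornerRel.preimage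
      (f := fun q : I × I × I => ((q.1 : ℝ), (q.2.1 : ℝ) - γ ((q.1 : ℝ) : UnitAddCircle), (q.2.2 : ℝ))) ?_
    have : Continuous fun q : I × I × I => ((q.1 : ℝ) : UnitAddCircle) :=
      (AddCircle.continuous_mk' 1).comp (by fun_prop)
    fun_prop
  have : pointBlowUp γ = (fun q : I × I × I => ((((q.1 : ℝ) : UnitAddCircle), q.2.1), q.2.2)) '' S := by
    ext ⟨⟨θ, y⟩, v⟩
    constructor
    · rintro ⟨x, hx, rfl, h⟩
      exact ⟨(⟨x, hx⟩, y, v), h, rfl⟩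
    · rintro ⟨⟨x, y', v'⟩, h, e⟩
      simp only [Prod.mk.injEq] at e
      obtain ⟨⟨rfl, rfl⟩, rfl⟩ := e
      exact ⟨x, x.2, rfl, h⟩
  rw [this]
  refine (hS.isCompact.image ?_).isClosed
  have : Continuous fun q : I × I × I => ((q.1 : ℝ) : UnitAddCircle) :=
    (AddCircle.continuous_mk' 1).comp (by fun_prop)
  fun_prop

lemma coe_eq_zero_of_mem_Icc {x : ℝ} (hx : x ∈ Icc (0 : ℝ) 1) :
    (x : UnitAddCircle) = 0 ↔ x = 0 ∨ x = 1 := by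
  constructor
  · intro h
    obtain ⟨n, hn⟩ := (AddCircle.coe_eq_zero_iff 1).1 h
    simp only [zsmul_eq_mul, mul_one] at hn
    obtain ⟨h0, h1⟩ := hx
    rw [← hn] at h0 h1 ⊢
    have h0' : 0 ≤ n := by exact_mod_cast h0
    have h1' : n ≤ 1 := by exact_mod_cast h1
    have : n = 0 ∨ n = 1 := by omega
    exact_mod_cast this
  · rintro (rfl | rfl)
    · simp
    · exact AddCircle.coe_period 1

lemma eq_of_coe_eq_of_mem_Icc {x y : ℝ} (hx : x ∈ Icc (0 : ℝ) 1) (hy : y ∈ Icc (0 : ℝ) 1)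
    (h : (x : UnitAddCircle) = y) (h0 : (x : UnitAddCircle) ≠ 0) : x = y := by
  have hx' := (coe_eq_zero_of_mem_Icc hx).not.1 h0
  have hy' := (coe_eq_zero_of_mem_Icc hy).not.1 (h ▸ h0)
  push Not at hx' hy'
  have : ((x - y : ℝ) : UnitAddCircle) = 0 := by
    rw [AddCircle.coe_sub, h, sub_self]
  obtain ⟨n, hn⟩ := (AddCircle.coe_eq_zero_iff 1).1 this
  simp only [zsmul_eq_mul, mul_one] at hn
  have a1 : x < 1 := lt_of_le_of_ne hx.2 hx'.2
  have a2 : y < 1 := lt_of_le_of_ne hy.2 hy'.2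
  have a3 := hx.1
  have a4 := hy.1
  have b1 : (n : ℝ) < 1 := by linarith
  have b2 : (-1 : ℝ) < n := by linarith
  have b1' : n < 1 := by exact_mod_cast b1
  have b2' : -1 < n := by exact_mod_cast b2
  have : n = 0 := by omega
  subst this
  simp at hn
  linarith

lemma pointBlowUp_le {γ : UnitAddCircle → I} {θ : UnitAddCircle} {y y' v v' : I}
    (h : ((θ, y), v) ∈ pointBlowUp γ) (h' : ((θ, y'), v') ∈ pointBlowUp γ) (hy : y ≤ y')
    (hne : ¬(θ = 0 ∧ y = γ 0 ∧ y' = γ 0)) : v ≤ v' := by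
  obtain ⟨x, hx, rfl, h⟩ := h
  obtain ⟨x', hx', hxx, h'⟩ := h'
  dsimp only at h h' hxx
  by_cases h0 : (x : UnitAddCircle) = 0
  · have ex := (coe_eq_zero_of_mem_Icc hx).1 h0
    have ex' := (coe_eq_zero_of_mem_Icc hx').1 (hxx.trans h0)
    rw [h0] at h h'
    have hyy : (y : ℝ) ≤ y' := hy
    -- Over θ = 0 the value is 0 below the curve and 1 above it, so comparison can fail only when
    -- both points are the centre of the blow-up.
    rcases lt_or_ge (γ 0 : ℝ) y' with hs | hs
    · have := h'.eq_one_of_pos ex' (by linarith) v'.2.2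
      have h1 := v.2.2
      exact (show (v : ℝ) ≤ v' by linarith)
    · rcases lt_or_ge (y : ℝ) (γ 0) with ht | ht
      · have := h.eq_zero_of_neg ex (by linarith) v.2.1
        have h1 := v'.2.1
        exact (show (v : ℝ) ≤ v' by linarith)
      · exact absurd ⟨h0, Subtype.ext (by linarith), Subtype.ext (by linarith)⟩ hne
  · have e : x' = x := (eq_of_coe_eq_of_mem_Icc hx hx' hxx.symm h0).symm
    subst e
    have hx0 := (coe_eq_zero_of_mem_Icc hx).not.1 h0
    push Not at hx0
    exact CornerRel.le_of_le (lt_of_le_of_ne hx.1 hx0.1.symm) (lt_of_le_of_ne hx.2 hx0.2)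
      (sub_le_sub_right (show (y : ℝ) ≤ y' from hy) _) v.2.1 v'.2.2 h h'

lemma exists_rep (θ : UnitAddCircle) : ∃ x ∈ Icc (0 : ℝ) 1, (x : UnitAddCircle) = θ := by
  obtain ⟨x, hx, h⟩ := (AddCircle.coe_image_Icc_eq (1 : ℝ) 0).ge (mem_univ θ)
  exact ⟨x, by simpa using hx, h⟩

lemma exists_mem_pointBlowUp (γ : UnitAddCircle → I) (p : UnitAddCircle × I) :
    ∃ v, (p, v) ∈ pointBlowUp γ := by
  obtain ⟨x, hx, h⟩ := exists_rep p.1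
  obtain ⟨v, hv, hr⟩ := CornerRel.exists hx ((p.2 : ℝ) - γ p.1)
  exact ⟨⟨v, hv⟩, x, hx, h, hr⟩

lemma mem_pointBlowUp_curve {γ : UnitAddCircle → I} {θ : UnitAddCircle} {v : I} :
    ((θ, γ θ), v) ∈ pointBlowUp γ ↔ θ = 0 ∨ ((v : ℝ) : UnitAddCircle) = -θ := by
  have key : ∀ x : ℝ, ((1 - x : ℝ) : UnitAddCircle) = -(x : UnitAddCircle) := by
    intro x
    rw [AddCircle.coe_sub, AddCircle.coe_period, zero_sub]
  constructor
  · rintro ⟨x, hx, rfl, h⟩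
    simp only [sub_self] at h
    rcases (CornerRel.zero_iff hx v.2).1 h with h | h | h
    · exact Or.inl ((coe_eq_zero_of_mem_Icc hx).2 (Or.inl h))
    · exact Or.inl ((coe_eq_zero_of_mem_Icc hx).2 (Or.inr h))
    · right; rw [h]; exact key x
  · rintro (rfl | h)
    · exact ⟨0, by simp, by simp, by simpa using (CornerRel.zero_iff (by simp) v.2).2 (Or.inl rfl)⟩
    · refine ⟨1 - v, ⟨by linarith [v.2.2], by linarith [v.2.1]⟩, by simp [key, h], ?_⟩
      simp only [sub_self]
      exact (CornerRel.zero_iff ⟨by linarith [v.2.2], by linarith [v.2.1]⟩ v.2).2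
        (Or.inr (Or.inr (by ring)))

/-! ### Inverse iterates of a forced map that need not be onto -/

lemma IsForcedIncreasing.injective {α : UnitAddCircle} {f : UnitAddCircle × I → UnitAddCircle × I}
    (hf : IsForcedIncreasing (fun θ => θ + α) f) : Function.Injective f := by
  rintro ⟨θ, x⟩ ⟨θ', x'⟩ h
  have h1 : θ = θ' := by
    have := congrArg Prod.fst h
    rw [hf.2.1, hf.2.1] at this
    exact add_right_cancel this
  subst h1
  have := (hf.2.2 θ).injective (congrArg Prod.snd h)
  rw [this]

lemma IsForcedIncreasing.apply_curve {α : UnitAddCircle}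
    {f : UnitAddCircle × I → UnitAddCircle × I} {γ : UnitAddCircle → I}
    (hf : IsForcedIncreasing (fun θ => θ + α) f) (hΓ : f '' graph γ = graph γ)
    (θ : UnitAddCircle) : f (θ, γ θ) = (θ + α, γ (θ + α)) := by
  have : f (θ, γ θ) ∈ graph γ := hΓ ▸ mem_image_of_mem f ⟨θ, rfl⟩
  obtain ⟨θ', h⟩ := this
  have h1 : θ' = θ + α := by
    have := congrArg Prod.fst h
    rwa [hf.2.1] at this
  rw [← h, h1]

lemma IsForcedIncreasing.apply_mem_curve_iff {α : UnitAddCircle}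
    {f : UnitAddCircle × I → UnitAddCircle × I} {γ : UnitAddCircle → I}
    (hf : IsForcedIncreasing (fun θ => θ + α) f) (hΓ : f '' graph γ = graph γ)
    (p : UnitAddCircle × I) : (f p).2 = γ (f p).1 ↔ p.2 = γ p.1 := by
  obtain ⟨θ, y⟩ := p
  constructor
  · intro h
    have h1 : f (θ, y) = f (θ, γ θ) := by
      rw [hf.apply_curve hΓ]
      refine Prod.ext (hf.2.1 _) ?_
      rw [h, hf.2.1]
    exact congrArg Prod.snd (hf.injective h1)
  · intro h
    dsimp only at h
    rw [h, hf.apply_curve hΓ]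

lemma IsForcedIncreasing.exists_leftInverse {α : UnitAddCircle}
    {f : UnitAddCircle × I → UnitAddCircle × I} {γ : UnitAddCircle → I}
    (hf : IsForcedIncreasing (fun θ => θ + α) f) (hΓ : f '' graph γ = graph γ)
    (h01 : ∀ θ, (γ θ : ℝ) ∈ Ioo (0 : ℝ) 1) :
    ∃ e : UnitAddCircle × I → UnitAddCircle × I, Continuous e ∧ (∀ p, (e p).1 = p.1 - α) ∧
      (∀ θ, Monotone fun x : I => (e (θ, x)).2) ∧ (∀ p, e (f p) = p) ∧
      ∀ p, (e p).2 = γ (e p).1 ↔ p.2 = γ p.1 := by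
  obtain ⟨hc, hfst, hmono⟩ := hf
  have hf : IsForcedIncreasing (fun θ => θ + α) f := ⟨hc, hfst, hmono⟩
  -- The fibre maps may miss part of the interval, so `r` clamps a point into the image of `f`
  -- before inverting. The curve lies strictly inside the image, so clamping moves no point onto or
  -- off it.
  let r : UnitAddCircle × I → UnitAddCircle × I := fun p =>
    (p.1, max (f (p.1 - α, 0)).2 (min p.2 (f (p.1 - α, 1)).2))
  have hr : Continuous r := by fun_prop
  have hex : ∀ p, ∃ y : I, f (p.1 - α, y) = r p := by
    intro p
    have h0 : (f (p.1 - α, 0)).2 ≤ (f (p.1 - α, 1)).2 := (hmono _).monotone zero_le_one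
    have : (r p).2 ∈ range fun y : I => (f (p.1 - α, y)).2 :=
      mem_range_of_exists_le_of_exists_ge (by fun_prop) ⟨0, le_max_left _ _⟩
        ⟨1, max_le h0 (min_le_right _ _)⟩
    obtain ⟨y, hy⟩ := this
    exact ⟨y, Prod.ext (by simp [hfst, r]) hy⟩
  choose y hy using hex
  have hemb : IsEmbedding f := (hc.isClosedEmbedding hf.injective).isEmbedding
  refine ⟨fun p => (p.1 - α, y p), ?_, fun p => rfl, ?_, ?_, ?_⟩
  -- By compactness `f` is an embedding, so continuity can be tested after composing with `f`, which
  -- gives `r`.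
  · rw [hemb.continuous_iff]
    convert hr using 1
    exact funext hy
  · intro θ x x' hx
    change y (θ, x) ≤ y (θ, x')
    rw [← (hmono (θ - α)).le_iff_le]
    have h1 := congrArg Prod.snd (hy (θ, x))
    have h2 := congrArg Prod.snd (hy (θ, x'))
    dsimp only at h1 h2
    rw [h1, h2]
    exact max_le_max le_rfl (min_le_min hx le_rfl)
  · intro p
    apply hf.injective
    dsimp only
    rw [hy]
    have e1 : (f p).1 - α = p.1 := by rw [hfst]; simp
    refine Prod.ext rfl ?_
    dsimp only [r]
    rw [e1, min_eq_left ((hmono p.1).monotone (show p.2 ≤ 1 from p.2.2.2)),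
      max_eq_right ((hmono p.1).monotone (show 0 ≤ p.2 from p.2.2.1))]
  · intro p
    rw [← hf.apply_mem_curve_iff hΓ, hy]
    change max _ _ = γ p.1 ↔ _
    have hγ : f (p.1 - α, γ (p.1 - α)) = (p.1, γ p.1) := by
      rw [hf.apply_curve hΓ]; simp
    have hγ' : (f (p.1 - α, γ (p.1 - α))).2 = γ p.1 := by rw [hγ]
    have l0 : (f (p.1 - α, 0)).2 < γ p.1 :=
      hγ' ▸ hmono (p.1 - α) (show (0 : I) < _ from (h01 _).1)
    have l1 : γ p.1 < (f (p.1 - α, 1)).2 :=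
      hγ' ▸ hmono (p.1 - α) (show _ < (1 : I) from (h01 _).2)
    constructor
    · intro h
      rcases le_total p.2 (f (p.1 - α, 1)).2 with h2 | h2
      · rw [min_eq_left h2] at h
        rcases le_total (f (p.1 - α, 0)).2 p.2 with h3 | h3
        · rwa [max_eq_right h3] at h
        · rw [max_eq_left h3] at h
          exact absurd h l0.ne
      · rw [min_eq_right h2, max_eq_right (l0.trans l1).le] at h
        exact absurd h l1.ne'
    · intro h
      rw [h, min_eq_left l1.le, max_eq_right l0.le]

/-- A family of maps playing the role of the inverse iterates `f ^ (-n)`, `n ∈ ℤ`. -/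
structure IsInverseFamily (α : UnitAddCircle) (f : UnitAddCircle × I → UnitAddCircle × I)
    (γ : UnitAddCircle → I) (E : ℤ → UnitAddCircle × I → UnitAddCircle × I) : Prop where
  continuous : ∀ n, Continuous (E n)
  fst : ∀ n p, (E n p).1 = p.1 - n • α
  mono : ∀ n θ, Monotone fun x : I => (E n (θ, x)).2
  curve_iff : ∀ n p, (E n p).2 = γ (E n p).1 ↔ p.2 = γ p.1
  shift : ∀ n p, E (n + 1) (f p) = E n p

lemma monotone_iterate_fibre {β : UnitAddCircle} {e : UnitAddCircle × I → UnitAddCircle × I}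
    (he : ∀ p, (e p).1 = p.1 + β) (hm : ∀ θ, Monotone fun x : I => (e (θ, x)).2) (n : ℕ) :
    ∀ θ, Monotone fun x : I => (e^[n] (θ, x)).2 := by
  induction n with
  | zero => exact fun θ x y h => h
  | succ n ih =>
    intro θ x y h
    simp only [Function.iterate_succ, Function.comp_apply]
    have e1 : ∀ x, e (θ, x) = (θ + β, (e (θ, x)).2) := fun x => Prod.ext (he _) rfl
    rw [e1 x, e1 y]
    exact ih _ (hm θ h)

lemma fst_iterate {β : UnitAddCircle} {e : UnitAddCircle × I → UnitAddCircle × I}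
    (he : ∀ p, (e p).1 = p.1 + β) (n : ℕ) (p) : (e^[n] p).1 = p.1 + n • β := by
  induction n with
  | zero => simp
  | succ n ih => rw [Function.iterate_succ_apply', he, ih, succ_nsmul, add_assoc]

lemma curve_iff_iterate {e : UnitAddCircle × I → UnitAddCircle × I} {γ : UnitAddCircle → I}
    (he : ∀ p, (e p).2 = γ (e p).1 ↔ p.2 = γ p.1) (n : ℕ) (p) :
    (e^[n] p).2 = γ (e^[n] p).1 ↔ p.2 = γ p.1 := by
  induction n with
  | zero => simp
  | succ n ih => rw [Function.iterate_succ_apply', he, ih]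

lemma IsForcedIncreasing.exists_isInverseFamily {α : UnitAddCircle}
    {f : UnitAddCircle × I → UnitAddCircle × I} {γ : UnitAddCircle → I}
    (hf : IsForcedIncreasing (fun θ => θ + α) f) (hΓ : f '' graph γ = graph γ)
    (h01 : ∀ θ, (γ θ : ℝ) ∈ Ioo (0 : ℝ) 1) : ∃ E, IsInverseFamily α f γ E := by
  obtain ⟨e, hec, hefst, hem, hef, hecurve⟩ := hf.exists_leftInverse hΓ h01
  have hefst' : ∀ p, (e p).1 = p.1 + -α := by simpa [sub_eq_add_neg] using hefst
  -- Non-negative indices iterate the left inverse; negative indices iterate `f` itself.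
  refine ⟨fun n => match n with
    | Int.ofNat k => e^[k]
    | Int.negSucc k => f^[k + 1], ?_, ?_, ?_, ?_, ?_⟩
  · rintro (k | k)
    · exact hec.iterate k
    · exact hf.1.iterate (k + 1)
  · rintro (k | k) p
    · rw [Int.ofNat_eq_natCast, natCast_zsmul]
      simpa [sub_eq_add_neg] using fst_iterate hefst' k p
    · rw [negSucc_zsmul, sub_neg_eq_add]
      exact fst_iterate hf.2.1 (k + 1) p
  · rintro (k | k)
    · exact monotone_iterate_fibre hefst' hem k
    · exact monotone_iterate_fibre hf.2.1 (fun θ => (hf.2.2 θ).monotone) (k + 1)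
  · rintro (k | k)
    · exact curve_iff_iterate hecurve k
    · exact curve_iff_iterate (hf.apply_mem_curve_iff hΓ) (k + 1)
  · rintro (k | k) p
    · change e^[k + 1] (f p) = e^[k] p
      rw [Function.iterate_succ_apply, hef]
    · cases k with
      | zero => rfl
      | succ k =>
        change f^[k + 1] (f p) = f^[k + 1 + 1] p
        rw [Function.iterate_succ_apply (n := k + 1)]

/-! ### Weighted heights and the flattening formula -/

/-- Positive weights indexed by the integers, with sum at most `1 / 2`. -/
noncomputable def weight : ℤ → ℝ := (posSumOfEncodable (one_half_pos (α := ℝ)) ℤ).1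

lemma weight_pos (n : ℤ) : 0 < weight n := (posSumOfEncodable (one_half_pos (α := ℝ)) ℤ).2.1 n

lemma summable_weight : Summable weight := by
  obtain ⟨c, hc, -⟩ := (posSumOfEncodable (one_half_pos (α := ℝ)) ℤ).2.2
  exact hc.summable

lemma tsum_weight_le : ∑' n, weight n ≤ 1 / 2 := by
  obtain ⟨c, hc, h⟩ := (posSumOfEncodable (one_half_pos (α := ℝ)) ℤ).2.2
  exact hc.tsum_eq.trans_le h

/-- The weighted sum of a sequence in the unit interval. -/
noncomputable def height (v : ℤ → I) : ℝ := ∑' n, weight n * v n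

lemma summable_height (v : ℤ → I) : Summable fun n => weight n * (v n : ℝ) :=
  summable_weight.of_nonneg_of_le (fun n => mul_nonneg (weight_pos n).le (v n).2.1)
    fun n => mul_le_of_le_one_right (weight_pos n).le (v n).2.2

lemma height_nonneg (v : ℤ → I) : 0 ≤ height v :=
  tsum_nonneg fun n => mul_nonneg (weight_pos n).le (v n).2.1

lemma height_le (v : ℤ → I) : height v ≤ 1 / 2 :=
  ((summable_height v).tsum_le_tsum
    (fun n => mul_le_of_le_one_right (weight_pos n).le (v n).2.2) summable_weight).trans
    tsum_weight_le

lemma height_mono : Monotone height := fun v v' h =>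
  (summable_height v).tsum_le_tsum
    (fun n => mul_le_mul_of_nonneg_left (show (v n : ℝ) ≤ v' n from h n) (weight_pos n).le)
    (summable_height v')

lemma height_strictMono : StrictMono height := by
  intro v v' h
  obtain ⟨h1, n, hn⟩ := Pi.lt_def.1 h
  exact (summable_height v).tsum_lt_tsum (i := n)
    (fun n => mul_le_mul_of_nonneg_left (show (v n : ℝ) ≤ v' n from h1 n) (weight_pos n).le)
    (mul_lt_mul_of_pos_left (show (v n : ℝ) < v' n from hn) (weight_pos n)) (summable_height v')

lemma continuous_height : Continuous height := by
  refine continuous_tsum (fun n => by fun_prop) summable_weight fun n v => ?_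
  rw [Real.norm_of_nonneg (mul_nonneg (weight_pos n).le (v n).2.1)]
  exact mul_le_of_le_one_right (weight_pos n).le (v n).2.2

/-- The vertical coordinate of the flattened blow-up. -/
noncomputable def level (y : I) (v : ℤ → I) : I :=
  ⟨y + y * (1 - y) * height v, by
    have h0 := y.2.1
    have h1 : 0 ≤ 1 - (y : ℝ) := by linarith [y.2.2]
    have h2 := height_nonneg v
    have h3 := height_le v
    constructor
    · positivity
    · nlinarith [mul_nonneg h0 h1]⟩

lemma continuous_level : Continuous fun q : I × (ℤ → I) => level q.1 q.2 := by
  have := continuous_height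
  refine Continuous.subtype_mk ?_ _
  fun_prop

/-- The change is split into moving y with v fixed, then moving v with y' fixed. Since the height is
at most 1/2 and |1 - y - y'| ≤ 1, the factor of y' - y stays positive. -/
lemma level_sub (y y' : I) (v v' : ℤ → I) : (level y' v' : ℝ) - level y v =
    ((y' : ℝ) - y) * (1 + height v * (1 - y - y')) + y' * (1 - y') * (height v' - height v) := by
  simp only [level]; ring

lemma level_le_level {y y' : I} {v v' : ℤ → I} (hy : y ≤ y') (hv : v ≤ v') :
    level y v ≤ level y' v' := by
  have h := level_sub y y' v v'
  have h1 : 0 ≤ (y' : ℝ) - y := sub_nonneg.2 hy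
  have h2 : 0 ≤ height v' - height v := sub_nonneg.2 (height_mono hv)
  have h3 : 0 ≤ 1 - (y' : ℝ) := by linarith [y'.2.2]
  have h4 : 0 ≤ 1 + height v * (1 - y - y') := by
    nlinarith [height_nonneg v, height_le v, y.2.2]
  have := add_nonneg (mul_nonneg h1 h4) (mul_nonneg (mul_nonneg y'.2.1 h3) h2)
  exact (show (level y v : ℝ) ≤ level y' v' by linarith)

lemma level_lt_level {y y' : I} {v v' : ℤ → I} (hy : y ≤ y') (hv : v ≤ v')
    (h : y < y' ∨ 0 < (y : ℝ) ∧ (y : ℝ) < 1 ∧ v < v') : level y v < level y' v' := by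
  have hsub := level_sub y y' v v'
  have h1 : 0 ≤ (y' : ℝ) - y := sub_nonneg.2 hy
  have h2 : 0 ≤ height v' - height v := sub_nonneg.2 (height_mono hv)
  have h3 : 0 ≤ 1 - (y' : ℝ) := by linarith [y'.2.2]
  have h4 : 0 < 1 + height v * (1 - y - y') := by
    nlinarith [height_nonneg v, height_le v, y.2.2]
  have h5 := mul_nonneg (mul_nonneg y'.2.1 h3) h2
  have h6 := mul_nonneg h1 h4.le
  suffices (level y v : ℝ) < level y' v' from this
  rcases hy.lt_or_eq with hlt | rfl
  · have := mul_pos (sub_pos.2 (show (y : ℝ) < y' from hlt)) h4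
    linarith
  · obtain ⟨g1, g2, g3⟩ := h.resolve_left (lt_irrefl _)
    have := mul_pos (mul_pos g1 (sub_pos.2 g2)) (sub_pos.2 (height_strictMono g3))
    linarith

/-! ### The simultaneous blow-up along an orbit -/

/-- A forced increasing interval map over an irrational rotation, with an invariant curve in the
interior and a family of inverse iterates. -/
structure IsCurveSystem (α : UnitAddCircle) (f : UnitAddCircle × I → UnitAddCircle × I)
    (γ : UnitAddCircle → I) (E : ℤ → UnitAddCircle × I → UnitAddCircle × I) : Prop
    extends IsInverseFamily α f γ E where
  free : ∀ n : ℤ, n • α = 0 → n = 0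
  curve_continuous : Continuous γ
  curve_mem : ∀ θ, (γ θ : ℝ) ∈ Ioo (0 : ℝ) 1
  forced : IsForcedIncreasing (fun θ => θ + α) f
  image_graph : f '' graph γ = graph γ

/-- The simultaneous blow-up of the annulus along an orbit on the curve `γ`. -/
def blowUp (γ : UnitAddCircle → I) (E : ℤ → UnitAddCircle × I → UnitAddCircle × I) :
    Set ((UnitAddCircle × I) × (ℤ → I)) :=
  {z | ∀ n, (E n z.1, z.2 n) ∈ pointBlowUp γ}

/-- A closed set with connected fibres over a connected space is connected. -/
lemma isPreconnected_of_fibres {X V : Type*} [TopologicalSpace X] [TopologicalSpace V]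
    [PreconnectedSpace X] [CompactSpace V] {S : Set (X × V)} (hS : IsClosed S)
    (hne : ∀ x, ∃ v, (x, v) ∈ S) (hfib : ∀ x, IsPreconnected {v | (x, v) ∈ S}) :
    IsPreconnected S := by
  rw [isPreconnected_closed_iff]
  rintro A B hA hB hAB ⟨a, haS, haA⟩ ⟨b, hbS, hbB⟩
  have cA : IsClosed (Prod.fst '' (S ∩ A)) := isClosedMap_fst_of_compactSpace _ (hS.inter hA)
  have cB : IsClosed (Prod.fst '' (S ∩ B)) := isClosedMap_fst_of_compactSpace _ (hS.inter hB)
  -- Compactness of the second factor makes the projections of the two pieces closed, so they meet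
  -- over some base point; connectedness of that fibre then produces a common point.
  obtain ⟨x, -, ⟨⟨x1, v⟩, ⟨hvS, hvA⟩, rfl⟩, ⟨⟨x2, v'⟩, ⟨hvS', hvB⟩, h⟩⟩ :=
    isPreconnected_closed_iff.1 (isPreconnected_univ (α := X)) _ _ cA cB (by
      intro x _
      obtain ⟨v, hv⟩ := hne x
      rcases hAB hv with h | h
      · exact Or.inl ⟨_, ⟨hv, h⟩, rfl⟩
      · exact Or.inr ⟨_, ⟨hv, h⟩, rfl⟩)
      ⟨a.1, mem_univ _, a, ⟨haS, haA⟩, rfl⟩ ⟨b.1, mem_univ _, b, ⟨hbS, hbB⟩, rfl⟩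
  dsimp only at h hvS hvA
  subst h
  obtain ⟨w, hwS, hwA, hwB⟩ := isPreconnected_closed_iff.1 (hfib x2) {v | (x2, v) ∈ A}
    {v | (x2, v) ∈ B} (hA.preimage (by fun_prop)) (hB.preimage (by fun_prop))
    (fun w hw => hAB hw) ⟨v, hvS, hvA⟩ ⟨v', hvS', hvB⟩
  exact ⟨(x2, w), hwS, hwA, hwB⟩

namespace IsCurveSystem

variable {α : UnitAddCircle} {f : UnitAddCircle × I → UnitAddCircle × I}
  {γ : UnitAddCircle → I} {E : ℤ → UnitAddCircle × I → UnitAddCircle × I}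

lemma isClosed_blowUp (hS : IsCurveSystem α f γ E) : IsClosed (blowUp γ E) := by
  simp only [blowUp, ofPred_forall]
  refine isClosed_iInter fun n => (isClosed_pointBlowUp hS.curve_continuous).preimage ?_
  have := hS.continuous n
  fun_prop

lemma inverse_curve (hS : IsCurveSystem α f γ E) (n : ℤ) (θ : UnitAddCircle) :
    E n (θ, γ θ) = (θ - n • α, γ (θ - n • α)) := by
  have h1 := hS.fst n (θ, γ θ)
  refine Prod.ext h1 ?_
  rw [(hS.curve_iff n (θ, γ θ)).2 rfl, h1]

lemma mem_blowUp_curve (hS : IsCurveSystem α f γ E) {θ : UnitAddCircle} {v : ℤ → I} :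
    ((θ, γ θ), v) ∈ blowUp γ E ↔
      ∀ n : ℤ, θ = n • α ∨ (((v n : I) : ℝ) : UnitAddCircle) = n • α - θ := by
  refine forall_congr' fun n => ?_
  dsimp only
  rw [hS.inverse_curve, mem_pointBlowUp_curve, sub_eq_zero, neg_sub]

lemma blowUp_le (hS : IsCurveSystem α f γ E) {θ : UnitAddCircle} {y y' : I} {v v' : ℤ → I}
    (h : ((θ, y), v) ∈ blowUp γ E) (h' : ((θ, y'), v') ∈ blowUp γ E) (hy : y ≤ y')
    (hne : ¬(y = γ θ ∧ y' = γ θ)) : v ≤ v' := by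
  intro n
  have e : ∀ y, E n (θ, y) = (θ - n • α, (E n (θ, y)).2) := fun y => Prod.ext (hS.fst n _) rfl
  have h1 := h n
  have h2 := h' n
  dsimp only at h1 h2
  rw [e] at h1 h2
  refine pointBlowUp_le h1 h2 (hS.mono n θ hy) ?_
  rintro ⟨h3, h4, h5⟩
  refine hne ⟨(hS.curve_iff n (θ, y)).1 ?_, (hS.curve_iff n (θ, y')).1 ?_⟩
  · rw [h4, hS.fst, h3]
  · rw [h5, hS.fst, h3]

lemma blowUp_eq (hS : IsCurveSystem α f γ E) {θ : UnitAddCircle} {y : I} {v v' : ℤ → I}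
    (h : ((θ, y), v) ∈ blowUp γ E) (h' : ((θ, y), v') ∈ blowUp γ E) (hy : y ≠ γ θ) : v = v' :=
  le_antisymm (hS.blowUp_le h h' le_rfl fun h => hy h.1)
    (hS.blowUp_le h' h le_rfl fun h => hy h.1)

lemma blowUp_curve_eq (hS : IsCurveSystem α f γ E) {θ : UnitAddCircle} {v v' : ℤ → I} {n : ℤ}
    (h : ((θ, γ θ), v) ∈ blowUp γ E) (h' : ((θ, γ θ), v') ∈ blowUp γ E) (hn : θ ≠ n • α) :
    v n = v' n := by
  have h1 := (hS.mem_blowUp_curve.1 h n).resolve_left hn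
  have h2 := (hS.mem_blowUp_curve.1 h' n).resolve_left hn
  refine Subtype.ext (eq_of_coe_eq_of_mem_Icc (v n).2 (v' n).2 (h1.trans h2.symm) ?_)
  rw [h1]
  exact sub_ne_zero.2 hn.symm

lemma orbit_injective (hS : IsCurveSystem α f γ E) {m n : ℤ} (h : m • α = n • α) : m = n := by
  have := hS.free (m - n) (by rw [sub_zsmul, h, add_neg_cancel])
  omega

/-- Freeness of the rotation lets nα equal mα only for m = n, so every other coordinate is pinned
down by the sawtooth. -/
lemma blowUp_curve_eq_update (hS : IsCurveSystem α f γ E) {v v' : ℤ → I} {n : ℤ}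
    (h : ((n • α, γ (n • α)), v) ∈ blowUp γ E) (h' : ((n • α, γ (n • α)), v') ∈ blowUp γ E) :
    v' = Function.update v n (v' n) := by
  refine Function.eq_update_iff.2 ⟨rfl, fun m hm => ?_⟩
  exact hS.blowUp_curve_eq h' h fun e => hm (hS.orbit_injective e).symm

lemma update_mem_blowUp (hS : IsCurveSystem α f γ E) {v : ℤ → I} {n : ℤ}
    (h : ((n • α, γ (n • α)), v) ∈ blowUp γ E) (t : I) :
    ((n • α, γ (n • α)), Function.update v n t) ∈ blowUp γ E := by
  rw [hS.mem_blowUp_curve] at h ⊢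
  intro m
  rcases eq_or_ne m n with rfl | hm
  · exact Or.inl rfl
  · rw [Function.update_of_ne hm]
    exact h m

lemma blowUp_curve_eq_of_forall_ne (hS : IsCurveSystem α f γ E) {θ : UnitAddCircle}
    {v v' : ℤ → I} (h : ((θ, γ θ), v) ∈ blowUp γ E) (h' : ((θ, γ θ), v') ∈ blowUp γ E)
    (hn : ∀ n : ℤ, θ ≠ n • α) : v = v' :=
  funext fun n => hS.blowUp_curve_eq h h' (hn n)

/-- Different heights are compared by monotonicity, and at equal heights at most one coordinate can
differ. Totality is what upgrades monotonicity of `level` to an order embedding on each fibre. -/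
lemma blowUp_total (hS : IsCurveSystem α f γ E) {θ : UnitAddCircle} {y y' : I} {v v' : ℤ → I}
    (h : ((θ, y), v) ∈ blowUp γ E) (h' : ((θ, y'), v') ∈ blowUp γ E) :
    (y ≤ y' ∧ v ≤ v') ∨ (y' ≤ y ∧ v' ≤ v) := by
  rcases lt_trichotomy y y' with hy | rfl | hy
  · exact Or.inl ⟨hy.le, hS.blowUp_le h h' hy.le fun e => hy.ne (e.1.trans e.2.symm)⟩
  · by_cases hc : y = γ θ
    · subst hc
      by_cases hn : ∃ n : ℤ, θ = n • α
      · obtain ⟨n, rfl⟩ := hn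
        rw [hS.blowUp_curve_eq_update h h', update_le_iff, le_update_iff]
        rcases le_total (v n) (v' n) with e | e
        · exact Or.inl ⟨le_rfl, e, fun _ _ => le_rfl⟩
        · exact Or.inr ⟨le_rfl, e, fun _ _ => le_rfl⟩
      · push Not at hn
        rw [hS.blowUp_curve_eq_of_forall_ne h h' hn]
        exact Or.inl ⟨le_rfl, le_rfl⟩
    · rw [hS.blowUp_eq h h' hc]
      exact Or.inl ⟨le_rfl, le_rfl⟩
  · exact Or.inr ⟨hy.le, hS.blowUp_le h' h hy.le fun e => hy.ne (e.1.trans e.2.symm)⟩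

lemma exists_mem_blowUp (γ : UnitAddCircle → I) (E : ℤ → UnitAddCircle × I → UnitAddCircle × I)
    (p : UnitAddCircle × I) : ∃ v, (p, v) ∈ blowUp γ E := by
  choose v hv using fun n => exists_mem_pointBlowUp γ (E n p)
  exact ⟨v, hv⟩

lemma isPreconnected_blowUp_fibre (hS : IsCurveSystem α f γ E) (p : UnitAddCircle × I) :
    IsPreconnected {v | (p, v) ∈ blowUp γ E} := by
  obtain ⟨θ, y⟩ := p
  by_cases hc : y = γ θ
  · subst hc
    by_cases hn : ∃ n : ℤ, θ = n • α
    · obtain ⟨n, rfl⟩ := hn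
      obtain ⟨v, hv⟩ := exists_mem_blowUp γ E (n • α, γ (n • α))
      have : {v | ((n • α, γ (n • α)), v) ∈ blowUp γ E} = range (Function.update v n) := by
        ext v'
        constructor
        · intro h
          exact ⟨v' n, (hS.blowUp_curve_eq_update hv h).symm⟩
        · rintro ⟨t, rfl⟩
          exact hS.update_mem_blowUp hv t
      rw [this]
      exact isPreconnected_range (continuous_const.update n continuous_id)
    · push Not at hn
      exact Set.Subsingleton.isPreconnected fun v hv v' hv' =>
        hS.blowUp_curve_eq_of_forall_ne hv hv' hn
  · exact Set.Subsingleton.isPreconnected fun v hv v' hv' => hS.blowUp_eq hv hv' hc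

end IsCurveSystem

/-! ### Flattening the blow-up onto the annulus -/

/-- The flattening map from the blow-up to the annulus. -/
noncomputable def flatten (γ : UnitAddCircle → I)
    (E : ℤ → UnitAddCircle × I → UnitAddCircle × I) (z : blowUp γ E) : UnitAddCircle × I :=
  (z.1.1.1, level z.1.1.2 z.1.2)

namespace IsCurveSystem

variable {α : UnitAddCircle} {f : UnitAddCircle × I → UnitAddCircle × I}
  {γ : UnitAddCircle → I} {E : ℤ → UnitAddCircle × I → UnitAddCircle × I}

lemma continuous_flatten : Continuous (flatten γ E) := by
  have h := continuous_level.comp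
    (f := fun z : blowUp γ E => ((z.1.1.2, z.1.2) : I × (ℤ → I))) (by fun_prop)
  exact Continuous.prodMk (by fun_prop) h

lemma level_lt_of_ne (hS : IsCurveSystem α f γ E) {θ : UnitAddCircle} {y y' : I} {v v' : ℤ → I}
    (h : ((θ, y), v) ∈ blowUp γ E) (h' : ((θ, y'), v') ∈ blowUp γ E)
    (hy : y ≤ y') (hv : v ≤ v') (hne : (y, v) ≠ (y', v')) : level y v < level y' v' := by
  refine level_lt_level hy hv ?_
  rcases hy.lt_or_eq with hlt | rfl
  · exact Or.inl hlt
  · right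
    have hvv : v ≠ v' := fun e => hne (by rw [e])
    have hc : y = γ θ := by
      by_contra hc
      exact hvv (hS.blowUp_eq h h' hc)
    rw [hc]
    exact ⟨(hS.curve_mem θ).1, (hS.curve_mem θ).2, lt_of_le_of_ne hv hvv⟩

lemma level_le_iff (hS : IsCurveSystem α f γ E) {θ : UnitAddCircle} {y y' : I} {v v' : ℤ → I}
    (h : ((θ, y), v) ∈ blowUp γ E) (h' : ((θ, y'), v') ∈ blowUp γ E) :
    level y v ≤ level y' v' ↔ y ≤ y' ∧ v ≤ v' := by
  refine ⟨fun hl => ?_, fun e => level_le_level e.1 e.2⟩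
  rcases hS.blowUp_total h h' with e | e
  · exact e
  · by_cases hne : (y', v') = (y, v)
    · obtain ⟨rfl, rfl⟩ := Prod.mk.inj hne
      exact e
    · exact absurd hl (hS.level_lt_of_ne h' h e.1 e.2 hne).not_ge

lemma flatten_injective (hS : IsCurveSystem α f γ E) : Function.Injective (flatten γ E) := by
  rintro ⟨⟨⟨θ, y⟩, v⟩, h⟩ ⟨⟨⟨θ', y'⟩, v'⟩, h'⟩ e
  obtain ⟨e1, e2⟩ := Prod.mk.inj e
  dsimp only at e1 e2
  subst e1
  obtain ⟨a1, a2⟩ := (hS.level_le_iff h h').1 e2.le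
  obtain ⟨b1, b2⟩ := (hS.level_le_iff h' h).1 e2.ge
  have c1 := le_antisymm a1 b1
  have c2 := le_antisymm a2 b2
  subst c1 c2
  rfl

lemma flatten_surjective (hS : IsCurveSystem α f γ E) : Function.Surjective (flatten γ E) := by
  rintro ⟨θ, x⟩
  let S : Set (I × (ℤ → I)) := {q | ((θ, q.1), q.2) ∈ blowUp γ E}
  have hSc : IsPreconnected S :=
    isPreconnected_of_fibres (hS.isClosed_blowUp.preimage (by fun_prop))
      (fun y => exists_mem_blowUp γ E (θ, y)) fun y => hS.isPreconnected_blowUp_fibre (θ, y)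
  obtain ⟨v0, h0⟩ := exists_mem_blowUp γ E (θ, 0)
  obtain ⟨v1, h1⟩ := exists_mem_blowUp γ E (θ, 1)
  have := hSc.intermediate_value (a := (0, v0)) (b := (1, v1)) h0 h1 continuous_level.continuousOn
  -- The factor y(1-y) vanishes at both ends, so they are reached whatever the blow-up coordinates
  -- are.
  have e0 : level 0 v0 = 0 := Subtype.ext (by simp [level])
  have e1 : level 1 v1 = 1 := Subtype.ext (by simp [level])
  dsimp only at this
  rw [e0, e1] at this
  obtain ⟨⟨y, v⟩, hq, e⟩ := this (show x ∈ Icc 0 1 from ⟨x.2.1, x.2.2⟩)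
  exact ⟨⟨((θ, y), v), hq⟩, Prod.ext rfl e⟩

/-- The flattening map as a homeomorphism from the blow-up to the annulus. -/
noncomputable def flattenHomeo (hS : IsCurveSystem α f γ E) :
    blowUp γ E ≃ₜ UnitAddCircle × I :=
  haveI : CompactSpace (blowUp γ E) := isCompact_iff_compactSpace.1 hS.isClosed_blowUp.isCompact
  Continuous.homeoOfEquivCompactToT2
    (f := Equiv.ofBijective (flatten γ E) ⟨hS.flatten_injective, hS.flatten_surjective⟩)
    continuous_flatten

end IsCurveSystem

/-! ### The extension and its factor map -/

namespace IsCurveSystem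

variable {α : UnitAddCircle} {f : UnitAddCircle × I → UnitAddCircle × I}
  {γ : UnitAddCircle → I} {E : ℤ → UnitAddCircle × I → UnitAddCircle × I}

/-- The factor map from the blown-up annulus to the annulus. -/
noncomputable def proj (hS : IsCurveSystem α f γ E) (p : UnitAddCircle × I) : UnitAddCircle × I :=
  (hS.flattenHomeo.symm p).1.1

/-- The blow-up coordinates of a point of the blown-up annulus. -/
noncomputable def seq (hS : IsCurveSystem α f γ E) (p : UnitAddCircle × I) : ℤ → I :=
  (hS.flattenHomeo.symm p).1.2

lemma mem_blowUp (hS : IsCurveSystem α f γ E) (p : UnitAddCircle × I) :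
    (hS.proj p, hS.seq p) ∈ blowUp γ E := (hS.flattenHomeo.symm p).2

lemma shift_mem_blowUp (hS : IsCurveSystem α f γ E) {p : UnitAddCircle × I} {v : ℤ → I}
    (h : (p, v) ∈ blowUp γ E) : (f p, fun n => v (n - 1)) ∈ blowUp γ E := by
  intro n
  have h1 := hS.shift (n - 1) p
  rw [sub_add_cancel] at h1
  have h2 := h (n - 1)
  dsimp only at h2 ⊢
  rwa [h1]

/-- The extension of `f` to the blown-up annulus. -/
noncomputable def extension (hS : IsCurveSystem α f γ E) (p : UnitAddCircle × I) :
    UnitAddCircle × I :=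
  hS.flattenHomeo ⟨(f (hS.proj p), fun n => hS.seq p (n - 1)), hS.shift_mem_blowUp (hS.mem_blowUp p)⟩

lemma proj_flatten (hS : IsCurveSystem α f γ E) (z : blowUp γ E) :
    hS.proj (hS.flattenHomeo z) = z.1.1 := by
  rw [proj, Homeomorph.symm_apply_apply]

lemma seq_flatten (hS : IsCurveSystem α f γ E) (z : blowUp γ E) :
    hS.seq (hS.flattenHomeo z) = z.1.2 := by
  rw [seq, Homeomorph.symm_apply_apply]

lemma exists_of_mem_blowUp (hS : IsCurveSystem α f γ E) {q : UnitAddCircle × I} {v : ℤ → I}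
    (h : (q, v) ∈ blowUp γ E) : ∃ p, hS.proj p = q ∧ hS.seq p = v :=
  ⟨hS.flattenHomeo ⟨_, h⟩, hS.proj_flatten _, hS.seq_flatten _⟩

lemma ext_point (hS : IsCurveSystem α f γ E) {p q : UnitAddCircle × I}
    (h1 : hS.proj p = hS.proj q) (h2 : hS.seq p = hS.seq q) : p = q :=
  hS.flattenHomeo.symm.injective (Subtype.ext (Prod.ext h1 h2))

lemma continuous_proj (hS : IsCurveSystem α f γ E) : Continuous hS.proj :=
  (continuous_fst.comp continuous_subtype_val).comp hS.flattenHomeo.symm.continuous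

lemma continuous_seq (hS : IsCurveSystem α f γ E) : Continuous hS.seq :=
  (continuous_snd.comp continuous_subtype_val).comp hS.flattenHomeo.symm.continuous

lemma continuous_extension (hS : IsCurveSystem α f γ E) : Continuous hS.extension := by
  have h1 := hS.continuous_proj
  have h2 := hS.continuous_seq
  have h3 := hS.forced.1
  refine hS.flattenHomeo.continuous.comp (Continuous.subtype_mk ?_ _)
  fun_prop

lemma proj_extension (hS : IsCurveSystem α f γ E) (p : UnitAddCircle × I) :
    hS.proj (hS.extension p) = f (hS.proj p) := hS.proj_flatten _

lemma seq_extension (hS : IsCurveSystem α f γ E) (p : UnitAddCircle × I) (n : ℤ) :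
    hS.seq (hS.extension p) n = hS.seq p (n - 1) := by
  rw [extension, seq_flatten]

lemma proj_fst (hS : IsCurveSystem α f γ E) (p : UnitAddCircle × I) : (hS.proj p).1 = p.1 := by
  conv_rhs => rw [← hS.flattenHomeo.apply_symm_apply p]
  rfl

/-- This translates the fibre order of the flattened annulus into the product order of the blow-up,
so monotonicity can be checked without the flattening formula. -/
lemma snd_le_iff (hS : IsCurveSystem α f γ E) {p q : UnitAddCircle × I} (h : p.1 = q.1) :
    p.2 ≤ q.2 ↔ (hS.proj p).2 ≤ (hS.proj q).2 ∧ hS.seq p ≤ hS.seq q := by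
  have hp := hS.mem_blowUp p
  have hq := hS.mem_blowUp q
  have ep : hS.proj p = (p.1, (hS.proj p).2) := Prod.ext (hS.proj_fst p) rfl
  have eq : hS.proj q = (p.1, (hS.proj q).2) := Prod.ext ((hS.proj_fst q).trans h.symm) rfl
  rw [ep] at hp
  rw [eq] at hq
  rw [← hS.level_le_iff hp hq]
  have e : ∀ p, p.2 = level (hS.proj p).2 (hS.seq p) := fun p => by
    conv_lhs => rw [← hS.flattenHomeo.apply_symm_apply p]
    rfl
  rw [e p, e q]

lemma proj_surjective (hS : IsCurveSystem α f γ E) : Function.Surjective hS.proj := fun q => by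
  obtain ⟨v, hv⟩ := exists_mem_blowUp γ E q
  obtain ⟨p, hp, -⟩ := hS.exists_of_mem_blowUp hv
  exact ⟨p, hp⟩

lemma isFactorMap_proj (hS : IsCurveSystem α f γ E) : IsFactorMap hS.proj hS.extension f :=
  ⟨hS.continuous_proj, hS.proj_surjective, hS.proj_extension⟩

lemma extension_fst (hS : IsCurveSystem α f γ E) (p : UnitAddCircle × I) :
    (hS.extension p).1 = p.1 + α := by
  rw [← hS.proj_fst, hS.proj_extension, hS.forced.2.1, hS.proj_fst]

lemma extension_injective (hS : IsCurveSystem α f γ E) : Function.Injective hS.extension := by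
  intro p q h
  refine hS.ext_point (hS.forced.injective ?_) (funext fun n => ?_)
  · rw [← hS.proj_extension, ← hS.proj_extension, h]
  · have := hS.seq_extension p (n + 1)
    rw [h, hS.seq_extension, add_sub_cancel_right] at this
    exact this.symm

lemma isForcedIncreasing_extension (hS : IsCurveSystem α f γ E) :
    IsForcedIncreasing (fun θ => θ + α) hS.extension := by
  refine ⟨hS.continuous_extension, hS.extension_fst, fun θ => ?_⟩
  refine Monotone.strictMono_of_injective ?_ ?_
  · intro x x' h
    obtain ⟨h1, h2⟩ := (hS.snd_le_iff (p := (θ, x)) (q := (θ, x')) rfl).1 h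
    refine (hS.snd_le_iff ?_).2 ⟨?_, ?_⟩
    · rw [hS.extension_fst, hS.extension_fst]
    · rw [hS.proj_extension, hS.proj_extension]
      have e : ∀ x : I, hS.proj (θ, x) = (θ, (hS.proj (θ, x)).2) := fun x =>
        Prod.ext (hS.proj_fst _) rfl
      rw [e x, e x']
      exact (hS.forced.2.2 θ).monotone h1
    · intro n
      rw [hS.seq_extension, hS.seq_extension]
      exact h2 _
  · intro x x' h
    have : hS.extension (θ, x) = hS.extension (θ, x') := by
      refine Prod.ext ?_ h
      rw [hS.extension_fst, hS.extension_fst]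
    exact congrArg Prod.snd (hS.extension_injective this)

lemma monotone_proj (hS : IsCurveSystem α f γ E) (θ : UnitAddCircle) :
    Monotone fun x : I => (hS.proj (θ, x)).2 := fun x x' h =>
  ((hS.snd_le_iff (p := (θ, x)) (q := (θ, x')) rfl).1 h).1

lemma mem_preimage_graph (hS : IsCurveSystem α f γ E) {p : UnitAddCircle × I} :
    p ∈ hS.proj ⁻¹' graph γ ↔ hS.proj p = (p.1, γ p.1) := by
  constructor
  · rintro ⟨θ, h⟩
    have h1 : θ = p.1 := (congrArg Prod.fst h).trans (hS.proj_fst p)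
    rw [← h, ← h1]
  · intro h
    exact ⟨p.1, h.symm⟩

lemma injOn_proj (hS : IsCurveSystem α f γ E) : InjOn hS.proj (hS.proj ⁻¹' graph γ)ᶜ := by
  intro p hp q hq h
  refine hS.ext_point h ?_
  have h1 := hS.mem_blowUp p
  have h2 := hS.mem_blowUp q
  rw [← h] at h2
  refine hS.blowUp_eq (θ := (hS.proj p).1) (y := (hS.proj p).2) h1 h2 fun e => hp ⟨(hS.proj p).1, ?_⟩
  dsimp only
  rw [← e]

/-! ### Fibres of the blown-up curve -/

lemma mem_blowUp_of_mem (hS : IsCurveSystem α f γ E) {p : UnitAddCircle × I}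
    (hp : p ∈ hS.proj ⁻¹' graph γ) : ((p.1, γ p.1), hS.seq p) ∈ blowUp γ E := by
  have := hS.mem_blowUp p
  rwa [hS.mem_preimage_graph.1 hp] at this

lemma coe_seq (hS : IsCurveSystem α f γ E) {p : UnitAddCircle × I}
    (hp : p ∈ hS.proj ⁻¹' graph γ) {n : ℤ} (hn : p.1 ≠ n • α) :
    ((hS.seq p n : ℝ) : UnitAddCircle) = n • α - p.1 :=
  (hS.mem_blowUp_curve.1 (hS.mem_blowUp_of_mem hp) n).resolve_left hn

/-- Away from the blown-up orbit, points of the blown-up curve are determined by the base point. -/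
lemma eq_of_fst_eq (hS : IsCurveSystem α f γ E) {p q : UnitAddCircle × I}
    (hp : p ∈ hS.proj ⁻¹' graph γ) (hq : q ∈ hS.proj ⁻¹' graph γ) (h : p.1 = q.1)
    (hn : ∀ n : ℤ, p.1 ≠ n • α) : p = q := by
  refine hS.ext_point ?_ ?_
  · rw [hS.mem_preimage_graph.1 hp, hS.mem_preimage_graph.1 hq, h]
  · have h2 := hS.mem_blowUp_of_mem hq
    rw [← h] at h2
    exact hS.blowUp_curve_eq_of_forall_ne (hS.mem_blowUp_of_mem hp) h2 hn

lemma exists_fst_eq (hS : IsCurveSystem α f γ E) (θ : UnitAddCircle) :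
    ∃ p ∈ hS.proj ⁻¹' graph γ, p.1 = θ := by
  obtain ⟨p, hp⟩ := hS.proj_surjective (θ, γ θ)
  exact ⟨p, ⟨θ, hp.symm⟩, by rw [← hS.proj_fst, hp]⟩

/-- Over the blown-up orbit, the coordinate of the corresponding index is arbitrary. -/
lemma exists_seq_eq (hS : IsCurveSystem α f γ E) (n : ℤ) (t : I) :
    ∃ p ∈ hS.proj ⁻¹' graph γ, p.1 = n • α ∧ hS.seq p n = t := by
  obtain ⟨v, hv⟩ := exists_mem_blowUp γ E (n • α, γ (n • α))
  obtain ⟨p, hp, hs⟩ := hS.exists_of_mem_blowUp (hS.update_mem_blowUp hv t)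
  exact ⟨p, ⟨_, hp.symm⟩, by rw [← hS.proj_fst, hp], by rw [hs, Function.update_self]⟩

lemma snd_le_of_seq_le (hS : IsCurveSystem α f γ E) {p q : UnitAddCircle × I} {n : ℤ}
    (hp : p ∈ hS.proj ⁻¹' graph γ) (hq : q ∈ hS.proj ⁻¹' graph γ) (hp1 : p.1 = n • α)
    (hq1 : q.1 = n • α) (h : hS.seq p n ≤ hS.seq q n) : p.2 ≤ q.2 := by
  refine (hS.snd_le_iff (hp1.trans hq1.symm)).2 ⟨?_, ?_⟩
  · rw [hS.mem_preimage_graph.1 hp, hS.mem_preimage_graph.1 hq, hp1, hq1]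
  · have h1 := hS.mem_blowUp_of_mem hp
    have h2 := hS.mem_blowUp_of_mem hq
    rw [hp1] at h1
    rw [hq1] at h2
    rw [hS.blowUp_curve_eq_update h1 h2]
    exact le_update_iff.2 ⟨h, fun _ _ => le_rfl⟩

/-- The end points are those whose free n-th coordinate is 0 and 1; monotonicity of the projection
fills in everything between. -/
lemma isVerticalSegment_preimage (hS : IsCurveSystem α f γ E) (n : ℤ) :
    IsVerticalSegment (hS.proj ⁻¹' {(n • α, γ (n • α))}) := by
  obtain ⟨p, hp, hp1, hp2⟩ := hS.exists_seq_eq n 0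
  obtain ⟨q, hq, hq1, hq2⟩ := hS.exists_seq_eq n 1
  have hpe := hS.mem_preimage_graph.1 hp
  have hqe := hS.mem_preimage_graph.1 hq
  rw [hp1] at hpe
  rw [hq1] at hqe
  have hpp : p = (n • α, p.2) := Prod.ext hp1 rfl
  have hqq : q = (n • α, q.2) := Prod.ext hq1 rfl
  refine ⟨n • α, p.2, q.2, lt_of_le_of_ne ?_ ?_, ?_⟩
  · exact hS.snd_le_of_seq_le hp hq hp1 hq1 (by rw [hp2]; exact (hS.seq q n).2.1)
  · intro h
    have : p = q := Prod.ext (hp1.trans hq1.symm) h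
    rw [this, hq2] at hp2
    exact one_ne_zero hp2
  · ext ⟨θ, x⟩
    simp only [mem_preimage, mem_singleton_iff, mem_prod, mem_Icc]
    constructor
    · intro h
      have hm : (θ, x) ∈ hS.proj ⁻¹' graph γ := ⟨_, h.symm⟩
      have h1 : θ = n • α := (hS.proj_fst (θ, x)).symm.trans (congrArg Prod.fst h)
      refine ⟨h1, ?_, ?_⟩
      · exact hS.snd_le_of_seq_le hp hm hp1 h1 (by rw [hp2]; exact (hS.seq _ n).2.1)
      · exact hS.snd_le_of_seq_le hm hq h1 hq1 (by rw [hq2]; exact (hS.seq _ n).2.2)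
    · rintro ⟨rfl, h1, h2⟩
      have g1 := hS.monotone_proj (n • α) h1
      have g2 := hS.monotone_proj (n • α) h2
      dsimp only at g1 g2
      rw [← hpp, hpe] at g1
      rw [← hqq, hqe] at g2
      exact Prod.ext (hS.proj_fst _) (le_antisymm g2 g1)

lemma exists_blownUp_points (hS : IsCurveSystem α f γ E) :
    ∃ C : Set (UnitAddCircle × I), C ⊆ graph γ ∧ C.Countable ∧ C.Infinite ∧
      (∀ p ∈ C, IsVerticalSegment (hS.proj ⁻¹' {p})) ∧
      ∀ p ∈ graph γ \ C, ∃ q, hS.proj ⁻¹' {p} = {q} := by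
  refine ⟨range fun n : ℤ => (n • α, γ (n • α)), ?_, countable_range _, ?_, ?_, ?_⟩
  · rintro _ ⟨n, rfl⟩
    exact ⟨_, rfl⟩
  · refine infinite_range_of_injective fun m n h => ?_
    exact hS.orbit_injective (congrArg Prod.fst h)
  · rintro _ ⟨n, rfl⟩
    exact hS.isVerticalSegment_preimage n
  · rintro _ ⟨⟨θ, rfl⟩, hC⟩
    obtain ⟨q, hq⟩ := hS.proj_surjective (θ, γ θ)
    refine ⟨q, Subset.antisymm ?_ (by rintro _ rfl; exact hq)⟩
    intro p hp
    have hp' : hS.proj p = (θ, γ θ) := hp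
    have e1 : p.1 = θ := by rw [← hS.proj_fst, hp']
    have e2 : q.1 = θ := by rw [← hS.proj_fst, hq]
    refine hS.eq_of_fst_eq ⟨θ, hp'.symm⟩ ⟨θ, hq.symm⟩ (e1.trans e2.symm) fun n hn => hC ⟨n, ?_⟩
    dsimp only
    rw [← hn, e1]

lemma ne_orbit_of_nsmul_eq_zero (hS : IsCurveSystem α f γ E) {β : UnitAddCircle} {k : ℕ}
    (hk : k ≠ 0) (h : k • β = 0) (hβ : β ≠ 0) (n : ℤ) : β ≠ n • α := by
  rintro rfl
  rw [← natCast_zsmul, smul_smul] at h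
  have := hS.free _ h
  rcases mul_eq_zero.1 this with h1 | h1
  · exact hk (by exact_mod_cast h1)
  · rw [h1, zero_smul] at hβ
    exact hβ rfl

/-- These points are non-zero torsion elements, while nα has infinite order for n ≠ 0. They supply
explicit regular base points tending to 0. -/
lemma coe_one_div_ne_orbit (hS : IsCurveSystem α f γ E) (k : ℕ) (n : ℤ) :
    ((1 / (k + 2 : ℝ) : ℝ) : UnitAddCircle) ≠ n • α := by
  have hk : (0 : ℝ) < k + 2 := by positivity
  refine hS.ne_orbit_of_nsmul_eq_zero (k := k + 2) (by omega) ?_ ?_ n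
  · rw [← AddCircle.coe_nsmul, nsmul_eq_mul]
    have : ((k + 2 : ℕ) : ℝ) * (1 / (k + 2 : ℝ)) = 1 := by
      push_cast
      field_simp
    rw [this]
    exact AddCircle.coe_period 1
  · have h1 : 1 / (k + 2 : ℝ) < 1 := by
      rw [div_lt_one hk]
      linarith [(Nat.cast_nonneg k : (0 : ℝ) ≤ k)]
    have h0 : 0 < 1 / (k + 2 : ℝ) := by positivity
    rw [Ne, coe_eq_zero_of_mem_Icc ⟨h0.le, h1.le⟩]
    rintro (h | h) <;> linarith

lemma isPinched (hS : IsCurveSystem α f γ E) : IsPinched (hS.proj ⁻¹' graph γ) := by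
  obtain ⟨p, hp, hp1⟩ := hS.exists_fst_eq ((1 / ((0 : ℕ) + 2 : ℝ) : ℝ) : UnitAddCircle)
  refine ⟨p.1, encard_eq_one.2 ⟨p.2, Subset.antisymm ?_ (by rintro _ rfl; exact hp)⟩⟩
  intro x hx
  refine congrArg Prod.snd (hS.eq_of_fst_eq (p := (p.1, x)) hx hp rfl fun n => ?_)
  rw [show ((p.1, x) : UnitAddCircle × I).1 = p.1 from rfl, hp1]
  exact hS.coe_one_div_ne_orbit 0 n

lemma seq_eq_one_sub (hS : IsCurveSystem α f γ E) {p : UnitAddCircle × I}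
    (hp : p ∈ hS.proj ⁻¹' graph γ) {x : ℝ} (hx : x ∈ Ioo (0 : ℝ) 1) (h : p.1 = x) :
    (hS.seq p 0 : ℝ) = 1 - x := by
  have hx0 : (x : UnitAddCircle) ≠ 0 := by
    rw [Ne, coe_eq_zero_of_mem_Icc ⟨hx.1.le, hx.2.le⟩]
    rintro (h | h)
    · exact hx.1.ne' h
    · exact hx.2.ne h
  have h1 := hS.coe_seq hp (n := 0) (by rw [h, zero_smul]; exact hx0)
  rw [h, zero_smul, zero_sub] at h1
  refine eq_of_coe_eq_of_mem_Icc (hS.seq p 0).2 ⟨by linarith [hx.2], by linarith [hx.1]⟩ ?_ ?_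
  · rw [h1, AddCircle.coe_sub, AddCircle.coe_period, zero_sub]
  · rw [h1]
    exact neg_ne_zero.2 hx0

/-- Along such a graph the coordinate of index 0 would be a continuous 1-periodic function equal to
1 - x on (0,1), which forces the values 1 and 0 at the same point of the circle. -/
lemma not_graph_subset (hS : IsCurveSystem α f γ E) (η : UnitAddCircle → I) (hη : Continuous η) :
    ¬graph η ⊆ hS.proj ⁻¹' graph γ := by
  intro h
  let g : ℝ → ℝ := fun x => hS.seq ((x : UnitAddCircle), η x) 0
  have hg : Continuous g := by
    have h1 := hS.continuous_seq
    have h2 : Continuous fun x : ℝ => (x : UnitAddCircle) := AddCircle.continuous_mk' 1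
    fun_prop
  have hE : EqOn g (fun x => 1 - x) (Ioo 0 1) := fun x hx =>
    hS.seq_eq_one_sub (h ⟨(x : UnitAddCircle), rfl⟩) hx rfl
  have hE' := hE.closure hg (by fun_prop)
  rw [closure_Ioo zero_ne_one] at hE'
  have h0 := hE' (show (0 : ℝ) ∈ Icc 0 1 by simp)
  have h1 := hE' (show (1 : ℝ) ∈ Icc 0 1 by simp)
  have h01 : g 0 = g 1 := by
    have : ((0 : ℝ) : UnitAddCircle) = ((1 : ℝ) : UnitAddCircle) := by
      rw [AddCircle.coe_period]; rfl
    simp only [g]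
    rw [this]
  dsimp only at h0 h1
  linarith

end IsCurveSystem

/-! ### Minimal sets and almost automorphy -/

/-- An injective continuous map restricts to a homeomorphism of a minimal set. -/
lemma IsMinimalSet.exists_homeomorph {X : Type*} [TopologicalSpace X] [T2Space X] [CompactSpace X]
    {F : X → X} {M : Set X} (hM : IsMinimalSet F M) (hF : Continuous F)
    (hinj : Function.Injective F) : ∃ g : M ≃ₜ M, ∀ x : M, (g x : X) = F x := by
  obtain ⟨hne, hcl, hmaps, hmin⟩ := hM
  have himg : F '' M = M := hmin _ hmaps.image_subset (hne.image F)
    (hcl.isCompact.image hF).isClosed fun x hx => ⟨x, hmaps.image_subset hx, rfl⟩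
  have : CompactSpace M := isCompact_iff_compactSpace.1 hcl.isCompact
  have hbij : Function.Bijective (hmaps.restrict F M M) := by
    refine ⟨fun x y h => Subtype.ext (hinj (congrArg Subtype.val h)), fun y => ?_⟩
    obtain ⟨x, hx, h⟩ := himg.ge y.2
    exact ⟨⟨x, hx⟩, Subtype.ext h⟩
  exact ⟨Continuous.homeoOfEquivCompactToT2 (f := Equiv.ofBijective _ hbij)
    (hF.restrict hmaps), fun x => rfl⟩

lemma zpow_apply_add {M A : Type*} [TopologicalSpace M] [AddCommGroup A] {π : M → A} {α : A}
    {g : M ≃ₜ M} (hg : ∀ x, π (g x) = π x + α) (n : ℤ) (x : M) : π ((g ^ n) x) = π x + n • α := by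
  have hinv : ∀ x, π (g⁻¹ x) = π x - α := fun x => by
    have := hg (g⁻¹ x)
    rw [Homeomorph.inv_apply, Homeomorph.apply_symm_apply] at this
    rw [this, Homeomorph.inv_apply, add_sub_cancel_right]
  induction n generalizing x with
  | zero => simp
  | succ n ih =>
    rw [zpow_add_one, Homeomorph.mul_apply, ih, hg, add_zsmul, one_zsmul]
    abel
  | pred n ih =>
    rw [zpow_sub_one, Homeomorph.mul_apply, ih, hinv, sub_zsmul, one_zsmul]
    abel

/-- A homeomorphism with an injective-over-a-point factor map onto a rotation is almost
automorphic. -/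
lemma almostAutomorphic_of_factor {M A : Type*} [MetricSpace M] [CompactSpace M] [AddCommGroup A]
    [TopologicalSpace A] [IsTopologicalAddGroup A] [T2Space A] {π : M → A} (hπ : Continuous π)
    {α : A} {g : M ≃ₜ M} (hg : ∀ x, π (g x) = π x + α) {x : M} (hx : ∀ y, π y = π x → y = x) :
    AlmostAutomorphic g := by
  refine ⟨x, fun n y h => ?_⟩
  have h1 : Tendsto (fun k => π x + n k • α) atTop (𝓝 (π y)) := by
    have := (hπ.tendsto y).comp h
    simpa [Function.comp_def, zpow_apply_add hg] using this
  have h2 : Tendsto (fun k => π ((g ^ (-n k)) y)) atTop (𝓝 (π x)) := by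
    have := (tendsto_const_nhds (x := π y + π x)).sub h1
    rw [add_sub_cancel_left] at this
    refine this.congr fun k => ?_
    rw [zpow_apply_add hg, neg_zsmul]
    abel
  -- By compactness it suffices to identify cluster points: each projects to the limit π x, over
  -- which x is the only point.
  refine le_nhds_of_unique_clusterPt fun z hz => hx z ?_
  have h3 : MapClusterPt (π z) atTop (fun k => π ((g ^ (-n k)) y)) :=
    MapClusterPt.continuousAt_comp hπ.continuousAt hz
  exact eq_of_nhds_neBot (ClusterPt.mono h3 h2)

namespace IsCurveSystem

variable {α : UnitAddCircle} {f : UnitAddCircle × I → UnitAddCircle × I}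
  {γ : UnitAddCircle → I} {E : ℤ → UnitAddCircle × I → UnitAddCircle × I}

lemma isClosed_preimage_graph (hS : IsCurveSystem α f γ E) :
    IsClosed (hS.proj ⁻¹' graph γ) := by
  have : hS.proj ⁻¹' graph γ = {p | hS.proj p = (p.1, γ p.1)} :=
    Set.ext fun p => hS.mem_preimage_graph
  rw [this]
  have := hS.curve_continuous
  exact isClosed_eq hS.continuous_proj (by fun_prop)

lemma mapsTo_preimage_graph (hS : IsCurveSystem α f γ E) :
    MapsTo hS.extension (hS.proj ⁻¹' graph γ) (hS.proj ⁻¹' graph γ) := by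
  intro p hp
  rw [hS.mem_preimage_graph] at hp ⊢
  rw [hS.proj_extension, hp, hS.forced.apply_curve hS.image_graph, hS.extension_fst]

/-- The points of the blown-up curve that do not lie over the blown-up orbit. -/
def regularPart (hS : IsCurveSystem α f γ E) : Set (UnitAddCircle × I) :=
  {p | p ∈ hS.proj ⁻¹' graph γ ∧ ∀ n : ℤ, p.1 ≠ n • α}

lemma mapsTo_regularPart (hS : IsCurveSystem α f γ E) :
    MapsTo hS.extension hS.regularPart hS.regularPart := by
  rintro p ⟨hp, hn⟩
  refine ⟨hS.mapsTo_preimage_graph hp, fun n h => hn (n - 1) ?_⟩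
  rw [hS.extension_fst] at h
  rw [sub_zsmul, one_zsmul, ← h, add_neg_cancel_right]

lemma closure_regularPart_subset (hS : IsCurveSystem α f γ E) :
    closure hS.regularPart ⊆ hS.proj ⁻¹' graph γ :=
  closure_minimal (fun _ hp => hp.1) hS.isClosed_preimage_graph

/-- The congruence holds on the regular part and is a closed condition. Over nα it leaves the n-th
coordinate only the values 0 and 1, which excludes the interior of the segment. -/
lemma coe_seq_of_mem_closure (hS : IsCurveSystem α f γ E) {p : UnitAddCircle × I}
    (hp : p ∈ closure hS.regularPart) (n : ℤ) :
    ((hS.seq p n : ℝ) : UnitAddCircle) = n • α - p.1 := by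
  have hc : IsClosed {p | ((hS.seq p n : ℝ) : UnitAddCircle) = n • α - p.1} := by
    have h1 := hS.continuous_seq
    have h2 : Continuous fun x : ℝ => (x : UnitAddCircle) := AddCircle.continuous_mk' 1
    exact isClosed_eq (h2.comp (by fun_prop)) (by fun_prop)
  exact closure_minimal (fun p hp => hS.coe_seq hp.1 (hp.2 n)) hc hp

lemma denseRange_nsmul (hS : IsCurveSystem α f γ E) : DenseRange fun n : ℕ => n • α := by
  have : Fact ((0 : ℝ) < 1) := ⟨one_pos⟩
  rw [← denseRange_zsmul_iff_nsmul, AddCircle.denseRange_zsmul_iff, addOrderOf_eq_zero_iff']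
  intro n hn h
  have := hS.free n (by rwa [natCast_zsmul])
  omega

lemma iterate_extension_fst (hS : IsCurveSystem α f γ E) (n : ℕ) (p : UnitAddCircle × I) :
    (hS.extension^[n] p).1 = p.1 + n • α := fst_iterate hS.extension_fst n p

/-- The projection of K is closed and contains a dense forward orbit of the rotation, hence is the
whole circle; over a regular base point K must contain the only point available. -/
lemma closure_regularPart_subset_of_mapsTo (hS : IsCurveSystem α f γ E)
    {K : Set (UnitAddCircle × I)} (hK : K ⊆ hS.proj ⁻¹' graph γ) (hne : K.Nonempty)
    (hcl : IsClosed K) (hmaps : MapsTo hS.extension K K) : closure hS.regularPart ⊆ K := by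
  obtain ⟨p, hp⟩ := hne
  have himg : Prod.fst '' K = univ := by
    refine eq_univ_of_univ_subset ?_
    have hd : DenseRange fun n : ℕ => p.1 + n • α :=
      (Homeomorph.addLeft p.1).surjective.denseRange.comp hS.denseRange_nsmul
        (Homeomorph.addLeft p.1).continuous
    rw [← hd.closure_range]
    refine closure_minimal ?_ (hcl.isCompact.image continuous_fst).isClosed
    rintro _ ⟨n, rfl⟩
    exact ⟨_, hmaps.iterate n hp, hS.iterate_extension_fst n p⟩
  refine closure_minimal ?_ hcl
  rintro q ⟨hq, hn⟩
  obtain ⟨q', hq', h⟩ := himg.ge (mem_univ q.1)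
  rwa [hS.eq_of_fst_eq hq (hK hq') h.symm hn]

lemma exists_mem_regularPart (hS : IsCurveSystem α f γ E) {θ : UnitAddCircle}
    (hθ : ∀ n : ℤ, θ ≠ n • α) : ∃ p ∈ hS.regularPart, p.1 = θ := by
  obtain ⟨p, hp, rfl⟩ := hS.exists_fst_eq θ
  exact ⟨p, ⟨hp, hθ⟩, rfl⟩

lemma isMinimalSet_closure_regularPart (hS : IsCurveSystem α f γ E) :
    IsMinimalSet hS.extension (closure hS.regularPart) := by
  refine ⟨?_, isClosed_closure, hS.mapsTo_regularPart.closure hS.continuous_extension, ?_⟩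
  · obtain ⟨p, hp, -⟩ := hS.exists_mem_regularPart (hS.coe_one_div_ne_orbit 0)
    exact ⟨p, subset_closure hp⟩
  · intro K hK hne hcl hmaps
    exact hK.antisymm (hS.closure_regularPart_subset_of_mapsTo
      (hK.trans hS.closure_regularPart_subset) hne hcl hmaps)

lemma eq_closure_regularPart (hS : IsCurveSystem α f γ E) {M : Set (UnitAddCircle × I)}
    (hM : M ⊆ hS.proj ⁻¹' graph γ) (hmin : IsMinimalSet hS.extension M) :
    M = closure hS.regularPart :=
  (hmin.2.2.2 _ (hS.closure_regularPart_subset_of_mapsTo hM hmin.1 hmin.2.1 hmin.2.2.1)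
    hS.isMinimalSet_closure_regularPart.1 isClosed_closure
    hS.isMinimalSet_closure_regularPart.2.2.1).symm

lemma almostAutomorphicOn (hS : IsCurveSystem α f γ E) :
    AlmostAutomorphicOn hS.extension (closure hS.regularPart) := by
  obtain ⟨g, hg⟩ := hS.isMinimalSet_closure_regularPart.exists_homeomorph hS.continuous_extension
    hS.extension_injective
  refine ⟨g, hg, ?_⟩
  have : CompactSpace (closure hS.regularPart) :=
    isCompact_iff_compactSpace.1 isClosed_closure.isCompact
  obtain ⟨p, hp, -⟩ := hS.exists_mem_regularPart (hS.coe_one_div_ne_orbit 0)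
  refine almostAutomorphic_of_factor (π := fun x : closure hS.regularPart => x.1.1) (by fun_prop)
    (α := α) (fun x => by rw [hg, hS.extension_fst]) (x := ⟨p, subset_closure hp⟩) fun y h => ?_
  refine Subtype.ext (hS.eq_of_fst_eq (hS.closure_regularPart_subset y.2) hp.1 h fun n => ?_)
  rw [h]
  exact hp.2 n

/-- Limits of regular points are found in a compact image. Approaching 0 from the right or from the
left of the circle reaches the two ends of the segment over 0. -/
lemma exists_mem_closure_of_tendsto (hS : IsCurveSystem α f γ E) {x : ℕ → ℝ} {a : ℝ} {b : I}
    (hx : ∀ k, x k ∈ Ioo (0 : ℝ) 1) (hn : ∀ k (n : ℤ), (x k : UnitAddCircle) ≠ n • α)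
    (ha : Tendsto x atTop (𝓝 a)) (hb : (b : ℝ) = 1 - a) :
    ∃ p ∈ closure hS.regularPart, p.1 = a ∧ hS.seq p 0 = b := by
  have hc := hS.continuous_seq
  have hcl : IsClosed ((fun p => (p.1, (hS.seq p 0 : ℝ))) '' closure hS.regularPart) :=
    (isClosed_closure.isCompact.image (by fun_prop)).isClosed
  have hlim : Tendsto (fun k => ((x k : UnitAddCircle), 1 - x k)) atTop
      (𝓝 ((a : UnitAddCircle), 1 - a)) :=
    Tendsto.prodMk_nhds (((AddCircle.continuous_mk' 1).tendsto a).comp ha)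
      (tendsto_const_nhds.sub ha)
  obtain ⟨p, hp, h⟩ := hcl.mem_of_tendsto hlim (Eventually.of_forall fun k => by
    obtain ⟨p, hp, h⟩ := hS.exists_mem_regularPart (hn k)
    exact ⟨p, subset_closure hp, Prod.ext h (hS.seq_eq_one_sub hp.1 (hx k) h)⟩)
  obtain ⟨h1, h2⟩ := Prod.mk.inj h
  exact ⟨p, hp, h1, Subtype.ext (h2.trans hb.symm)⟩

lemma one_div_mem_Ioo (k : ℕ) : 1 / (k + 2 : ℝ) ∈ Ioo (0 : ℝ) 1 := by
  refine ⟨by positivity, ?_⟩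
  rw [div_lt_one (by positivity)]
  linarith [(Nat.cast_nonneg k : (0 : ℝ) ≤ k)]

lemma tendsto_one_div_add_two : Tendsto (fun k : ℕ => 1 / (k + 2 : ℝ)) atTop (𝓝 0) := by
  have := (tendsto_add_atTop_iff_nat 1).2 (tendsto_one_div_add_atTop_nhds_zero_nat (𝕜 := ℝ))
  refine this.congr fun k => ?_
  push_cast
  ring

lemma exists_top (hS : IsCurveSystem α f γ E) :
    ∃ p ∈ closure hS.regularPart, p.1 = 0 ∧ hS.seq p 0 = 1 := by
  obtain ⟨p, hp, h1, h2⟩ := hS.exists_mem_closure_of_tendsto (b := 1) one_div_mem_Ioo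
    hS.coe_one_div_ne_orbit tendsto_one_div_add_two (by simp)
  exact ⟨p, hp, h1.trans (by simp), h2⟩

lemma exists_bot (hS : IsCurveSystem α f γ E) :
    ∃ p ∈ closure hS.regularPart, p.1 = 0 ∧ hS.seq p 0 = 0 := by
  have hx : ∀ k : ℕ, 1 - 1 / (k + 2 : ℝ) ∈ Ioo (0 : ℝ) 1 := fun k =>
    ⟨by linarith [(one_div_mem_Ioo k).2], by linarith [(one_div_mem_Ioo k).1]⟩
  have hn : ∀ (k : ℕ) (n : ℤ), ((1 - 1 / (k + 2 : ℝ) : ℝ) : UnitAddCircle) ≠ n • α := by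
    intro k n h
    refine hS.coe_one_div_ne_orbit k (-n) ?_
    rw [neg_zsmul, ← h, AddCircle.coe_sub, AddCircle.coe_period, zero_sub, neg_neg]
  have ht : Tendsto (fun k : ℕ => 1 - 1 / (k + 2 : ℝ)) atTop (𝓝 1) := by
    simpa using (tendsto_const_nhds (x := (1 : ℝ))).sub tendsto_one_div_add_two
  obtain ⟨p, hp, h1, h2⟩ := hS.exists_mem_closure_of_tendsto (b := 0) hx hn ht (by simp)
  exact ⟨p, hp, h1.trans (AddCircle.coe_period 1), h2⟩

lemma not_almostPeriodicOn (hS : IsCurveSystem α f γ E) :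
    ¬AlmostPeriodicOn hS.extension (closure hS.regularPart) := by
  rintro ⟨g, hg, hap⟩
  obtain ⟨p, hp, hp1, hp2⟩ := hS.exists_bot
  obtain ⟨q, hq, hq1, hq2⟩ := hS.exists_top
  let φ : closure hS.regularPart → ℝ := fun x => hS.seq x 0
  have hφ : Continuous φ := by
    have := hS.continuous_seq
    fun_prop
  obtain ⟨δ, hδ, h1⟩ := Metric.continuous_iff.1 hφ ⟨p, hp⟩ (1 / 2) one_half_pos
  obtain ⟨δ', hδ', h2⟩ := Metric.continuous_iff.1 hφ ⟨q, hq⟩ (1 / 2) one_half_pos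
  obtain ⟨L, hL⟩ := hap (min δ δ') (lt_min hδ hδ')
  -- Starting the syndetic window at 1 guarantees n ≠ 0.
  obtain ⟨n, hn, hn1, -⟩ := hL 1
  have h3 := h1 _ ((hn ⟨p, hp⟩).trans_le (min_le_left _ _))
  have h4 := h2 _ ((hn ⟨q, hq⟩).trans_le (min_le_right _ _))
  have hfst : ∀ x, ((g ^ n) x).1.1 = x.1.1 + n • α := fun x =>
    zpow_apply_add (π := fun x : closure hS.regularPart => x.1.1)
      (fun x => by rw [hg, hS.extension_fst]) n x
  have hne : n • α ≠ 0 := fun h => by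
    have := hS.free n h
    omega
  have hs : ∀ x : closure hS.regularPart, x.1.1 = 0 →
      ((φ ((g ^ n) x) : ℝ) : UnitAddCircle) = -(n • α) := fun x hx => by
    have := hS.coe_seq_of_mem_closure ((g ^ n) x).2 0
    rwa [hfst, hx, zero_zsmul, zero_add, zero_sub] at this
  have h5 := hs ⟨p, hp⟩ hp1
  have h6 := hs ⟨q, hq⟩ hq1
  -- Both images lie over nα ≠ 0, where the coordinate of index 0 is determined by the base point. A
  -- common value cannot be within 1/2 of both 0 and 1.
  have h7 : φ ((g ^ n) ⟨p, hp⟩) = φ ((g ^ n) ⟨q, hq⟩) := by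
    refine eq_of_coe_eq_of_mem_Icc (hS.seq _ 0).2 (hS.seq _ 0).2 (h5.trans h6.symm) ?_
    rw [h5]
    exact neg_ne_zero.2 hne
  have e1 : φ ⟨p, hp⟩ = 0 := by simp [φ, hp2]
  have e2 : φ ⟨q, hq⟩ = 1 := by simp [φ, hq2]
  rw [h7, e1, Real.dist_eq, abs_lt] at h3
  rw [e2, Real.dist_eq, abs_lt] at h4
  linarith [h3.2, h4.1]

lemma not_isFilledIn (hS : IsCurveSystem α f γ E) : ¬IsFilledIn (closure hS.regularPart) := by
  intro h
  obtain ⟨p, hp, hp1, hp2⟩ := hS.exists_bot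
  obtain ⟨q, hq, hq1, hq2⟩ := hS.exists_top
  obtain ⟨r, hr, hr1, hr2⟩ := hS.exists_seq_eq 0 ⟨1 / 2, by norm_num, by norm_num⟩
  have hp' := hS.closure_regularPart_subset hp
  have hq' := hS.closure_regularPart_subset hq
  have hpr : p.2 ≤ r.2 := hS.snd_le_of_seq_le (n := 0) hp' hr (by rw [hp1, zero_zsmul]) hr1
    (by rw [hp2]; exact (hS.seq r 0).2.1)
  have hrq : r.2 ≤ q.2 := hS.snd_le_of_seq_le (n := 0) hr hq' hr1 (by rw [hq1, zero_zsmul])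
    (by rw [hq2]; exact (hS.seq r 0).2.2)
  rw [zero_zsmul] at hr1
  have hrM : r ∈ closure hS.regularPart := by
    rw [h]
    refine ⟨(sInf_le ?_).trans hpr, hrq.trans (le_sSup ?_)⟩
    · change (r.1, p.2) ∈ closure hS.regularPart
      rwa [hr1, ← hp1]
    · change (r.1, q.2) ∈ closure hS.regularPart
      rwa [hr1, ← hq1]
  have h1 := hS.coe_seq_of_mem_closure hrM 0
  rw [hr2, hr1, zero_zsmul, sub_zero, coe_eq_zero_of_mem_Icc (by norm_num)] at h1
  norm_num at h1

end IsCurveSystem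

/-! ### The blown-up curve as a circle with Denjoy dynamics -/

lemma add_le_add_of_lt_of_integral {r r' v v' : ℝ} (hv : v ∈ Icc (0 : ℝ) 1)
    (hv' : v' ∈ Icc (0 : ℝ) 1) (h : (∃ k : ℤ, (k : ℝ) = r) ∨ ∃ k : ℤ, (k : ℝ) = v + r)
    (h' : (∃ k : ℤ, (k : ℝ) = r') ∨ ∃ k : ℤ, (k : ℝ) = v' + r') (hr : r < r') :
    v + r ≤ v' + r' := by
  obtain ⟨h0, h1⟩ := hv
  obtain ⟨h0', h1'⟩ := hv'
  -- For non-integral r the sum v + r is the ceiling of r; at an integer it may be anything in [r, r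
  -- + 1]. This is the ceiling function with its jumps filled in, hence monotone.
  rcases h with ⟨k, hk⟩ | ⟨k, hk⟩ <;> rcases h' with ⟨k', hk'⟩ | ⟨k', hk'⟩
  · have : k < k' := by exact_mod_cast (by linarith : (k : ℝ) < k')
    have : (k : ℝ) + 1 ≤ k' := by exact_mod_cast this
    linarith
  · have : k < k' := by exact_mod_cast (by linarith : (k : ℝ) < k')
    have : (k : ℝ) + 1 ≤ k' := by exact_mod_cast this
    linarith
  · have : k < k' + 1 := by exact_mod_cast (by linarith : (k : ℝ) < k' + 1)
    have : (k : ℝ) ≤ k' := by exact_mod_cast Int.lt_add_one_iff.1 this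
    linarith
  · have : k < k' + 1 := by exact_mod_cast (by linarith : (k : ℝ) < k' + 1)
    have : (k : ℝ) ≤ k' := by exact_mod_cast Int.lt_add_one_iff.1 this
    linarith

/-- Pairs of a real number and blow-up coordinates of a point of the blown-up curve above it. -/
def curveLine (γ : UnitAddCircle → I) (E : ℤ → UnitAddCircle × I → UnitAddCircle × I) :
    Set (ℝ × (ℤ → I)) :=
  {z | (((z.1 : UnitAddCircle), γ z.1), z.2) ∈ blowUp γ E}

namespace IsCurveSystem

variable {ω : ℝ} {f : UnitAddCircle × I → UnitAddCircle × I}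
  {γ : UnitAddCircle → I} {E : ℤ → UnitAddCircle × I → UnitAddCircle × I}

lemma curveLine_integral (hS : IsCurveSystem (ω : UnitAddCircle) f γ E) {x : ℝ} {v : ℤ → I}
    (h : (x, v) ∈ curveLine γ E) (n : ℤ) :
    (∃ k : ℤ, (k : ℝ) = x - n * ω) ∨ ∃ k : ℤ, (k : ℝ) = v n + (x - n * ω) := by
  refine (hS.mem_blowUp_curve.1 h n).imp (fun h => ?_) fun h => ?_
  · have : ((x - n * ω : ℝ) : UnitAddCircle) = 0 := by
      rw [AddCircle.coe_sub, h, ← zsmul_eq_mul, AddCircle.coe_zsmul, sub_self]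
    obtain ⟨k, hk⟩ := (AddCircle.coe_eq_zero_iff 1).1 this
    exact ⟨k, by simpa using hk⟩
  · have : ((v n + (x - n * ω) : ℝ) : UnitAddCircle) = 0 := by
      rw [AddCircle.coe_add, h, AddCircle.coe_sub, ← zsmul_eq_mul, AddCircle.coe_zsmul]
      abel
    obtain ⟨k, hk⟩ := (AddCircle.coe_eq_zero_iff 1).1 this
    exact ⟨k, by simpa using hk⟩

/-- Each v_n can drop by at most x' - x, so the weighted sum drops by at most half of that, and the
term x more than compensates. -/
lemma add_height_lt (hS : IsCurveSystem (ω : UnitAddCircle) f γ E) {x x' : ℝ} {v v' : ℤ → I}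
    (h : (x, v) ∈ curveLine γ E) (h' : (x', v') ∈ curveLine γ E) (hx : x < x') :
    x + height v < x' + height v' := by
  have h1 : height v ≤ height v' + (∑' n, weight n) * (x' - x) := by
    rw [height, height, ← tsum_mul_right,
      ← (summable_height v').tsum_add (summable_weight.mul_right _)]
    refine (summable_height v).tsum_le_tsum (fun n => ?_)
      ((summable_height v').add (summable_weight.mul_right _))
    rw [← mul_add]
    refine mul_le_mul_of_nonneg_left ?_ (weight_pos n).le
    have := add_le_add_of_lt_of_integral (v n).2 (v' n).2 (hS.curveLine_integral h n)
      (hS.curveLine_integral h' n) (by linarith)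
    linarith
  nlinarith [tsum_weight_le]

lemma add_height_le_iff (hS : IsCurveSystem (ω : UnitAddCircle) f γ E) {x x' : ℝ} {v v' : ℤ → I}
    (h : (x, v) ∈ curveLine γ E) (h' : (x', v') ∈ curveLine γ E) :
    x + height v ≤ x' + height v' ↔ x < x' ∨ x = x' ∧ v ≤ v' := by
  rcases lt_trichotomy x x' with hx | rfl | hx
  · simp [hx, (hS.add_height_lt h h' hx).le]
  · simp only [add_le_add_iff_left, lt_self_iff_false, true_and, false_or]
    refine ⟨fun hl => ?_, fun hl => height_mono hl⟩
    rcases hS.blowUp_total h h' with e | e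
    · exact e.2
    · by_contra hne
      exact hl.not_gt (height_strictMono (lt_of_le_of_ne e.2 fun e => hne e.ge))
  · simp [hx.not_gt, hx.ne', hS.add_height_lt h' h hx]

lemma curveLine_eq (hS : IsCurveSystem (ω : UnitAddCircle) f γ E) {x x' : ℝ} {v v' : ℤ → I}
    (h : (x, v) ∈ curveLine γ E) (h' : (x', v') ∈ curveLine γ E)
    (he : x + height v = x' + height v') : x = x' ∧ v = v' := by
  have h1 := (hS.add_height_le_iff h h').1 he.le
  have h2 := (hS.add_height_le_iff h' h).1 he.ge
  rcases h1 with h1 | ⟨h1, h3⟩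
  · rcases h2 with h2 | ⟨h2, -⟩ <;> linarith
  · rcases h2 with h2 | ⟨-, h4⟩
    · linarith
    · exact ⟨h1, le_antisymm h3 h4⟩

lemma add_int_mem_curveLine {x : ℝ} {v : ℤ → I} (h : (x, v) ∈ curveLine γ E) (k : ℤ) :
    (x + k, v) ∈ curveLine γ E := by
  have : ((x + k : ℝ) : UnitAddCircle) = x := by
    rw [AddCircle.coe_add, add_eq_left, AddCircle.coe_eq_zero_iff]
    exact ⟨k, by simp⟩
  change (((((x + k : ℝ)) : UnitAddCircle), _), v) ∈ blowUp γ E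
  rw [this]
  exact h

lemma shift_mem_curveLine (hS : IsCurveSystem (ω : UnitAddCircle) f γ E) {x : ℝ} {v : ℤ → I}
    (h : (x, v) ∈ curveLine γ E) (m : ℤ) :
    (x + m * ω, fun n => v (n - m)) ∈ curveLine γ E := by
  have e : ((x + m * ω : ℝ) : UnitAddCircle) = x + m • (ω : UnitAddCircle) := by
    rw [AddCircle.coe_add, ← zsmul_eq_mul, AddCircle.coe_zsmul]
  refine hS.mem_blowUp_curve.2 fun n => ?_
  rw [e]
  refine (hS.mem_blowUp_curve.1 h (n - m)).imp (fun h => ?_) fun h => ?_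
  · rw [h, sub_zsmul]
    abel
  · rw [h, sub_zsmul]
    abel

lemma exists_curveLine (hS : IsCurveSystem (ω : UnitAddCircle) f γ E) (t : ℝ) :
    ∃ x v, (x, v) ∈ curveLine γ E ∧ x + height v = t := by
  let S : Set (I × (ℤ → I)) := {q | ((q.1 : ℝ), q.2) ∈ curveLine γ E}
  have hq : Continuous fun x : I => ((x : ℝ) : UnitAddCircle) :=
    (AddCircle.continuous_mk' 1).comp continuous_subtype_val
  have hγ := hS.curve_continuous
  have hSc : IsPreconnected S :=
    isPreconnected_of_fibres (hS.isClosed_blowUp.preimage (f := fun q : I × (ℤ → I) =>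
      ((((q.1 : ℝ) : UnitAddCircle), γ (q.1 : ℝ)), q.2)) (by fun_prop))
      (fun y => exists_mem_blowUp γ E ((y : ℝ), γ (y : ℝ)))
      fun y => hS.isPreconnected_blowUp_fibre ((y : ℝ), γ (y : ℝ))
  obtain ⟨v, hv⟩ := exists_mem_blowUp γ E (((0 : ℝ) : UnitAddCircle), γ (0 : ℝ))
  have h0 : ((0 : I), v) ∈ S := hv
  have h1 : ((1 : I), v) ∈ S := by
    have := add_int_mem_curveLine (x := 0) (v := v) (γ := γ) (E := E) hv 1
    simpa [S] using this
  have := continuous_height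
  have hiv := hSc.intermediate_value h0 h1
    (f := fun q : I × (ℤ → I) => (q.1 : ℝ) + height q.2) (by fun_prop)
  -- With the same v at both ends, the values over [0,1] cover an interval of length one from
  -- `height v`; an integer translation brings t into it.
  obtain ⟨⟨x, w⟩, hq, e⟩ := hiv (show t - ⌊t - height v⌋ ∈ Icc _ _ from
    ⟨by simp; linarith [Int.floor_le (t - height v)],
      by simp; linarith [Int.lt_floor_add_one (t - height v)]⟩)
  refine ⟨x + ⌊t - height v⌋, w, add_int_mem_curveLine hq _, ?_⟩
  dsimp only at e
  linarith

/-- The base coordinate of the point of the lifted blown-up curve with parameter `t`. -/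
noncomputable def linePos (hS : IsCurveSystem (ω : UnitAddCircle) f γ E) (t : ℝ) : ℝ :=
  (hS.exists_curveLine t).choose

/-- The blow-up coordinates of the point of the lifted blown-up curve with parameter `t`. -/
noncomputable def lineSeq (hS : IsCurveSystem (ω : UnitAddCircle) f γ E) (t : ℝ) : ℤ → I :=
  (hS.exists_curveLine t).choose_spec.choose

lemma mem_curveLine (hS : IsCurveSystem (ω : UnitAddCircle) f γ E) (t : ℝ) :
    (hS.linePos t, hS.lineSeq t) ∈ curveLine γ E :=
  (hS.exists_curveLine t).choose_spec.choose_spec.1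

lemma linePos_add_height (hS : IsCurveSystem (ω : UnitAddCircle) f γ E) (t : ℝ) :
    hS.linePos t + height (hS.lineSeq t) = t :=
  (hS.exists_curveLine t).choose_spec.choose_spec.2

lemma line_eq (hS : IsCurveSystem (ω : UnitAddCircle) f γ E) {x : ℝ} {v : ℤ → I}
    (h : (x, v) ∈ curveLine γ E) :
    hS.linePos (x + height v) = x ∧ hS.lineSeq (x + height v) = v :=
  hS.curveLine_eq (hS.mem_curveLine _) h (hS.linePos_add_height _)

lemma le_iff_line (hS : IsCurveSystem (ω : UnitAddCircle) f γ E) {t t' : ℝ} :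
    t ≤ t' ↔ hS.linePos t < hS.linePos t' ∨
      hS.linePos t = hS.linePos t' ∧ hS.lineSeq t ≤ hS.lineSeq t' := by
  rw [← hS.add_height_le_iff (hS.mem_curveLine t) (hS.mem_curveLine t'), hS.linePos_add_height,
    hS.linePos_add_height]

lemma line_add_one (hS : IsCurveSystem (ω : UnitAddCircle) f γ E) (t : ℝ) :
    hS.linePos (t + 1) = hS.linePos t + 1 ∧ hS.lineSeq (t + 1) = hS.lineSeq t := by
  have h := hS.line_eq (add_int_mem_curveLine (hS.mem_curveLine t) 1)
  have e : hS.linePos t + (1 : ℤ) + height (hS.lineSeq t) = t + 1 := by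
    conv_rhs => rw [← hS.linePos_add_height t]
    push_cast
    ring
  rw [e] at h
  simpa using h

lemma linePos_mono (hS : IsCurveSystem (ω : UnitAddCircle) f γ E) : Monotone hS.linePos := by
  intro t t' h
  rcases hS.le_iff_line.1 h with h | h
  · exact h.le
  · exact h.1.le

/-- The base coordinate as a degree one lift. -/
noncomputable def linePosLift (hS : IsCurveSystem (ω : UnitAddCircle) f γ E) : CircleDeg1Lift :=
  ⟨⟨hS.linePos, hS.linePos_mono⟩, fun t => (hS.line_add_one t).1⟩

/-- The lift of the dynamics on the blown-up curve. -/
noncomputable def denjoyLift (hS : IsCurveSystem (ω : UnitAddCircle) f γ E) : CircleDeg1Lift where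
  toFun t := hS.linePos t + ω + height fun n => hS.lineSeq t (n - 1)
  monotone' := by
    intro t t' h
    have h1 := hS.shift_mem_curveLine (hS.mem_curveLine t) 1
    have h2 := hS.shift_mem_curveLine (hS.mem_curveLine t') 1
    simp only [Int.cast_one, one_mul] at h1 h2
    refine (hS.add_height_le_iff h1 h2).2 ?_
    refine (hS.le_iff_line.1 h).imp (fun h => by linarith) fun h => ⟨by rw [h.1], fun n => h.2 _⟩
  map_add_one' t := by
    rw [(hS.line_add_one t).1, (hS.line_add_one t).2]
    ring

lemma denjoyLift_apply (hS : IsCurveSystem (ω : UnitAddCircle) f γ E) (t : ℝ) :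
    hS.denjoyLift t = hS.linePos t + ω + height fun n => hS.lineSeq t (n - 1) := rfl

lemma continuous_denjoyLift (hS : IsCurveSystem (ω : UnitAddCircle) f γ E) :
    Continuous hS.denjoyLift := by
  -- A monotone surjection of the line is continuous; preimages come from shifting the coordinates
  -- back by one.
  refine hS.denjoyLift.monotone.continuous_of_surjective fun t => ?_
  obtain ⟨h1, h2⟩ := hS.line_eq (hS.shift_mem_curveLine (hS.mem_curveLine t) (-1))
  refine ⟨hS.linePos t + (-1 : ℤ) * ω + height fun n => hS.lineSeq t (n - -1), ?_⟩
  rw [hS.denjoyLift_apply, h1, h2]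
  have := hS.linePos_add_height t
  simp only [sub_neg_eq_add, sub_add_cancel]
  push_cast
  linarith

/-- The base coordinate is itself a degree one lift and semiconjugates the dynamics to translation
by ω, so the translation numbers agree. -/
lemma translationNumber_denjoyLift (hS : IsCurveSystem (ω : UnitAddCircle) f γ E) :
    hS.denjoyLift.translationNumber = ω := by
  refine (CircleDeg1Lift.translationNumber_eq_of_semiconj (f := hS.linePosLift)
    fun t => ?_).trans (CircleDeg1Lift.translationNumber_translate ω)
  rw [CircleDeg1Lift.translate_apply]
  have h := hS.shift_mem_curveLine (hS.mem_curveLine t) 1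
  simp only [Int.cast_one, one_mul] at h
  exact (hS.line_eq h).1.trans (add_comm _ _)

/-- The parameter on the circle of a point of the blown-up curve. -/
noncomputable def circleParam (hS : IsCurveSystem (ω : UnitAddCircle) f γ E)
    (p : hS.proj ⁻¹' graph γ) : UnitAddCircle :=
  p.1.1 + (height (hS.seq p.1) : UnitAddCircle)

lemma exists_circleParam_eq (hS : IsCurveSystem (ω : UnitAddCircle) f γ E) (t : ℝ) :
    ∃ p : hS.proj ⁻¹' graph γ, p.1.1 = hS.linePos t ∧ hS.seq p.1 = hS.lineSeq t ∧
      hS.circleParam p = t := by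
  obtain ⟨p, hp, hs⟩ := hS.exists_of_mem_blowUp (hS.mem_curveLine t)
  have hp1 : p.1 = hS.linePos t := by rw [← hS.proj_fst, hp]
  refine ⟨⟨p, ⟨_, hp.symm⟩⟩, hp1, hs, ?_⟩
  rw [circleParam, hp1, hs, ← AddCircle.coe_add, hS.linePos_add_height]

lemma circleParam_bijective (hS : IsCurveSystem (ω : UnitAddCircle) f γ E) :
    Function.Bijective hS.circleParam := by
  constructor
  · rintro ⟨p, hp⟩ ⟨q, hq⟩ h
    obtain ⟨x, hx⟩ := QuotientAddGroup.mk_surjective p.1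
    obtain ⟨y, hy⟩ := QuotientAddGroup.mk_surjective q.1
    have hpl : (x, hS.seq p) ∈ curveLine γ E := by
      have := hS.mem_blowUp_of_mem hp
      rwa [← hx] at this
    have hql : (y, hS.seq q) ∈ curveLine γ E := by
      have := hS.mem_blowUp_of_mem hq
      rwa [← hy] at this
    have h1 : ((x + height (hS.seq p) - (y + height (hS.seq q)) : ℝ) : UnitAddCircle) = 0 := by
      rw [AddCircle.coe_sub, AddCircle.coe_add, AddCircle.coe_add, sub_eq_zero]
      have : (x : UnitAddCircle) = p.1 := hx
      have : (y : UnitAddCircle) = q.1 := hy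
      simp only [*]
      exact h
    obtain ⟨k, hk⟩ := (AddCircle.coe_eq_zero_iff 1).1 h1
    simp only [zsmul_eq_mul, mul_one] at hk
    have hql' := add_int_mem_curveLine hql k
    obtain ⟨e1, e2⟩ := hS.curveLine_eq hpl hql' (by linarith)
    have e3 : p.1 = q.1 := by
      rw [← hx, ← hy]
      change (x : UnitAddCircle) = (y : UnitAddCircle)
      rw [e1, AddCircle.coe_add, add_eq_left, AddCircle.coe_eq_zero_iff]
      exact ⟨k, by simp⟩
    refine Subtype.ext (hS.ext_point ?_ e2)
    rw [hS.mem_preimage_graph.1 hp, hS.mem_preimage_graph.1 hq, e3]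
  · intro t
    obtain ⟨t, rfl⟩ := QuotientAddGroup.mk_surjective t
    obtain ⟨p, -, -, h⟩ := hS.exists_circleParam_eq t
    exact ⟨p, h⟩

/-- The circle as a parametrization of the blown-up curve. -/
noncomputable def circleHomeo (hS : IsCurveSystem (ω : UnitAddCircle) f γ E) :
    hS.proj ⁻¹' graph γ ≃ₜ UnitAddCircle :=
  haveI : CompactSpace (hS.proj ⁻¹' graph γ) :=
    isCompact_iff_compactSpace.1 hS.isClosed_preimage_graph.isCompact
  Continuous.homeoOfEquivCompactToT2 (f := Equiv.ofBijective _ hS.circleParam_bijective) (by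
    have h1 := hS.continuous_seq
    have h2 : Continuous fun x : ℝ => (x : UnitAddCircle) := AddCircle.continuous_mk' 1
    have h3 := continuous_height
    exact (continuous_fst.comp continuous_subtype_val).add
      (h2.comp (h3.comp (h1.comp continuous_subtype_val))))

lemma circleHomeo_apply (hS : IsCurveSystem (ω : UnitAddCircle) f γ E)
    (p : hS.proj ⁻¹' graph γ) : hS.circleHomeo p = hS.circleParam p := rfl

/-- Even if `f` misses part of the annulus, it permutes the curve, so base point and coordinates can
be shifted back. -/
lemma surjOn_extension (hS : IsCurveSystem (ω : UnitAddCircle) f γ E) :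
    SurjOn hS.extension (hS.proj ⁻¹' graph γ) (hS.proj ⁻¹' graph γ) := by
  intro q hq
  obtain ⟨t, ht⟩ := QuotientAddGroup.mk_surjective q.1
  have hql : (t, hS.seq q) ∈ curveLine γ E := by
    have := hS.mem_blowUp_of_mem hq
    rwa [← ht] at this
  obtain ⟨p, hp, hs⟩ := hS.exists_of_mem_blowUp (hS.shift_mem_curveLine hql (-1))
  refine ⟨p, ⟨_, hp.symm⟩, hS.ext_point ?_ (funext fun n => ?_)⟩
  · rw [hS.proj_extension, hp, hS.forced.apply_curve hS.image_graph, hS.mem_preimage_graph.1 hq,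
      ← ht]
    dsimp only
    rw [← AddCircle.coe_add]
    have : t + ((-1 : ℤ) : ℝ) * ω + ω = t := by push_cast; ring
    rw [this]
  · rw [hS.seq_extension, hs]
    simp

/-- The dynamics on the blown-up curve. -/
noncomputable def curveHomeo (hS : IsCurveSystem (ω : UnitAddCircle) f γ E) :
    hS.proj ⁻¹' graph γ ≃ₜ hS.proj ⁻¹' graph γ :=
  haveI : CompactSpace (hS.proj ⁻¹' graph γ) :=
    isCompact_iff_compactSpace.1 hS.isClosed_preimage_graph.isCompact
  Continuous.homeoOfEquivCompactToT2
    (f := Equiv.ofBijective (hS.mapsTo_preimage_graph.restrict hS.extension _ _)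
      ⟨(hS.mapsTo_preimage_graph.restrict_inj).2 hS.extension_injective.injOn,
        (hS.mapsTo_preimage_graph.restrict_surjective_iff).2 hS.surjOn_extension⟩)
    (hS.continuous_extension.restrict hS.mapsTo_preimage_graph)

lemma curveHomeo_apply (hS : IsCurveSystem (ω : UnitAddCircle) f γ E)
    (p : hS.proj ⁻¹' graph γ) : (hS.curveHomeo p : UnitAddCircle × I) = hS.extension p := rfl

/-- The circle homeomorphism conjugate to the dynamics on the blown-up curve. -/
noncomputable def denjoyHomeo (hS : IsCurveSystem (ω : UnitAddCircle) f γ E) :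
    UnitAddCircle ≃ₜ UnitAddCircle :=
  (hS.circleHomeo.symm.trans hS.curveHomeo).trans hS.circleHomeo

lemma symm_denjoyHomeo (hS : IsCurveSystem (ω : UnitAddCircle) f γ E) (t : UnitAddCircle) :
    hS.circleHomeo.symm (hS.denjoyHomeo t) = hS.curveHomeo (hS.circleHomeo.symm t) :=
  hS.circleHomeo.symm_apply_apply _

lemma denjoyHomeo_coe (hS : IsCurveSystem (ω : UnitAddCircle) f γ E) (t : ℝ) :
    ((hS.denjoyLift t : ℝ) : UnitAddCircle) = hS.denjoyHomeo (t : UnitAddCircle) := by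
  obtain ⟨p, hp1, hp2, hp3⟩ := hS.exists_circleParam_eq t
  have h1 : hS.circleHomeo.symm t = p := by
    rw [← hp3, ← hS.circleHomeo_apply, Homeomorph.symm_apply_apply]
  change _ = hS.circleHomeo (hS.curveHomeo (hS.circleHomeo.symm t))
  rw [h1, hS.circleHomeo_apply, circleParam, hS.curveHomeo_apply, hS.extension_fst, hp1,
    hS.denjoyLift_apply, AddCircle.coe_add, AddCircle.coe_add]
  have : hS.seq (hS.extension p) = fun n => hS.lineSeq t (n - 1) :=
    funext fun n => by rw [hS.seq_extension, hp2]
  rw [this]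

lemma symm_fst_zpow (hS : IsCurveSystem (ω : UnitAddCircle) f γ E) (m : ℤ) (t : UnitAddCircle) :
    (hS.circleHomeo.symm ((hS.denjoyHomeo ^ m) t)).1.1 =
      (hS.circleHomeo.symm t).1.1 + m • (ω : UnitAddCircle) :=
  zpow_apply_add (π := fun t => (hS.circleHomeo.symm t).1.1)
    (fun t => by rw [hS.symm_denjoyHomeo, hS.curveHomeo_apply, hS.extension_fst]) m t

lemma exists_wandering (hS : IsCurveSystem (ω : UnitAddCircle) f γ E) :
    ∃ a b : ℝ, a < b ∧ ∀ t ∈ Ioo a b, (hS.circleHomeo.symm (t : UnitAddCircle)).1.1 = 0 := by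
  obtain ⟨p, hp, hp1, hp2⟩ := hS.exists_seq_eq 0 0
  obtain ⟨q, hq, hq1, hq2⟩ := hS.exists_seq_eq 0 1
  rw [zero_zsmul] at hp1 hq1
  have hpl : ((0 : ℝ), hS.seq p) ∈ curveLine γ E := by
    have := hS.mem_blowUp_of_mem hp
    rwa [hp1] at this
  have hql : ((0 : ℝ), hS.seq q) ∈ curveLine γ E := by
    have := hS.mem_blowUp_of_mem hq
    rwa [hq1] at this
  refine ⟨0 + height (hS.seq p), 0 + height (hS.seq q), ?_, fun t ht => ?_⟩
  · by_contra! hle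
    rcases (hS.add_height_le_iff hql hpl).1 hle with h | h
    · exact lt_irrefl _ h
    · have := h.2 0
      rw [hp2, hq2] at this
      exact absurd this (by norm_num)
  -- The base coordinate is monotone and vanishes at both end parameters, so it vanishes between
  -- them.
  · have h1 := hS.linePos_mono ht.1.le
    have h2 := hS.linePos_mono ht.2.le
    rw [(hS.line_eq hpl).1] at h1
    rw [(hS.line_eq hql).1] at h2
    obtain ⟨r, hr1, -, hr3⟩ := hS.exists_circleParam_eq t
    rw [← hr3, ← hS.circleHomeo_apply, Homeomorph.symm_apply_apply, hr1, le_antisymm h2 h1]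
    rfl

lemma isDenjoyHomeo (hS : IsCurveSystem (ω : UnitAddCircle) f γ E) (hω : Irrational ω) :
    IsDenjoyHomeo hS.denjoyHomeo := by
  refine ⟨⟨hS.denjoyLift, hS.continuous_denjoyLift, hS.denjoyHomeo_coe, ?_⟩, ?_⟩
  · rwa [hS.translationNumber_denjoyLift]
  · obtain ⟨a, b, hab, h⟩ := hS.exists_wandering
    refine ⟨a, b, hab, fun m n hmn => disjoint_left.2 ?_⟩
    rintro _ ⟨_, ⟨s, hs, rfl⟩, rfl⟩ ⟨_, ⟨t, ht, rfl⟩, e⟩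
    have h1 := hS.symm_fst_zpow m s
    have h2 := hS.symm_fst_zpow n t
    rw [h s hs, zero_add] at h1
    rw [h t ht, zero_add] at h2
    dsimp only at e
    rw [e, h1] at h2
    exact hmn (hS.orbit_injective h2)

end IsCurveSystem

/-! ### Irrational rotations and the conclusion -/

lemma isCurveSystem_of_irrational {ω : ℝ} (hω : Irrational ω)
    {f : UnitAddCircle × I → UnitAddCircle × I} {γ : UnitAddCircle → I}
    (hf : IsForcedIncreasing (fun θ => θ + (ω : UnitAddCircle)) f) (hγ : Continuous γ)
    (h01 : ∀ θ, (γ θ : ℝ) ∈ Ioo (0 : ℝ) 1) (hΓ : f '' graph γ = graph γ) :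
    ∃ E, IsCurveSystem (ω : UnitAddCircle) f γ E := by
  obtain ⟨E, hE⟩ := hf.exists_isInverseFamily hΓ h01
  refine ⟨E, hE, fun n h => ?_, hγ, h01, hf, hΓ⟩
  rw [← AddCircle.coe_zsmul] at h
  obtain ⟨k, hk⟩ := (AddCircle.coe_eq_zero_iff 1).1 h
  simp only [zsmul_eq_mul, mul_one] at hk
  by_contra hn
  exact (hω.intCast_mul hn).ne_int k hk.symm

end ForcedInterval

open ForcedInterval in
theorem mainTheorem3 (ω : ℝ) (hω : Irrational ω) :
    (∀ (f : UnitAddCircle × I → UnitAddCircle × I) (γ : UnitAddCircle → I),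
      IsForcedIncreasing (fun θ => θ + (ω : UnitAddCircle)) f →
      Continuous γ →
      (∀ θ, (γ θ : ℝ) ∈ Ioo (0 : ℝ) 1) →
      f '' graph γ = graph γ →
      ∃ F h : UnitAddCircle × I → UnitAddCircle × I,
        -- `F` is a topological extension of `f` with factor map `h(θ, x) = (θ, h_θ(x))`
        IsFactorMap h F f ∧ (∀ p, (h p).1 = p.1) ∧
        -- (i)
        IsForcedIncreasing (fun θ => θ + (ω : UnitAddCircle)) F ∧
        -- (ii)
        (∀ θ, Monotone fun x : I => (h (θ, x)).2) ∧
        -- (iii)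
        InjOn h (h ⁻¹' graph γ)ᶜ ∧
        -- (iv)
        (∃ C : Set (UnitAddCircle × I), C ⊆ graph γ ∧ C.Countable ∧ C.Infinite ∧
          (∀ p ∈ C, IsVerticalSegment (h ⁻¹' {p})) ∧
          ∀ p ∈ graph γ \ C, ∃ q, h ⁻¹' {p} = {q}) ∧
        -- (v)
        (∀ η : UnitAddCircle → I, Continuous η → ¬ graph η ⊆ h ⁻¹' graph γ) ∧
        -- (vi)
        IsPinched (h ⁻¹' graph γ) ∧
        -- the preimage of the curve is a circle carrying dynamics of Denjoy type
        (∃ (ξ : UnitAddCircle ≃ₜ (h ⁻¹' graph γ)) (g : UnitAddCircle ≃ₜ UnitAddCircle),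
          IsDenjoyHomeo g ∧ ∀ t, F (ξ t) = ξ (g t)) ∧
        -- there is exactly one minimal set in it, with the stated properties
        ∃ M : Set (UnitAddCircle × I), M ⊆ h ⁻¹' graph γ ∧ IsMinimalSet F M ∧
          (∀ M' : Set (UnitAddCircle × I), M' ⊆ h ⁻¹' graph γ → IsMinimalSet F M' → M' = M) ∧
          AlmostAutomorphicOn F M ∧ ¬ AlmostPeriodicOn F M ∧ ¬ IsFilledIn M) ∧
    (∃ (F : UnitAddCircle × I → UnitAddCircle × I) (M : Set (UnitAddCircle × I)),
      IsForcedIncreasing (fun θ => θ + (ω : UnitAddCircle)) F ∧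
      IsMinimalSet F M ∧ AlmostAutomorphicOn F M ∧ ¬ IsFilledIn M) := by
  refine ⟨fun f γ hf hγ h01 hΓ => ?_, ?_⟩
  · obtain ⟨E, hS⟩ := isCurveSystem_of_irrational hω hf hγ h01 hΓ
    refine ⟨hS.extension, hS.proj, hS.isFactorMap_proj, hS.proj_fst,
      hS.isForcedIncreasing_extension, hS.monotone_proj, hS.injOn_proj, hS.exists_blownUp_points,
      hS.not_graph_subset, hS.isPinched,
      ⟨hS.circleHomeo.symm, hS.denjoyHomeo, hS.isDenjoyHomeo hω, fun t => ?_⟩,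
      closure hS.regularPart, hS.closure_regularPart_subset, hS.isMinimalSet_closure_regularPart,
      fun M' hM' hmin => hS.eq_closure_regularPart hM' hmin, hS.almostAutomorphicOn,
      hS.not_almostPeriodicOn, hS.not_isFilledIn⟩
    rw [hS.symm_denjoyHomeo, hS.curveHomeo_apply]
  -- For existence alone, the rotation times the identity with the constant curve 1/2 is a
  -- sufficient input.
  · obtain ⟨E, hS⟩ := isCurveSystem_of_irrational hω (f := fun p => (p.1 + (ω : UnitAddCircle), p.2))
      (γ := fun _ => ⟨1 / 2, by norm_num, by norm_num⟩)
      ⟨by fun_prop, fun _ => rfl, fun _ _ _ h => h⟩ continuous_const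
      (fun _ => by norm_num) (by
        ext ⟨θ, y⟩
        constructor
        · rintro ⟨_, ⟨θ', rfl⟩, h⟩
          exact ⟨θ' + (ω : UnitAddCircle), h⟩
        · rintro ⟨θ', h⟩
          refine ⟨_, ⟨θ' - (ω : UnitAddCircle), rfl⟩, ?_⟩
          rw [← h]
          exact Prod.ext (sub_add_cancel _ _) rfl)
    exact ⟨hS.extension, closure hS.regularPart, hS.isForcedIncreasing_extension,
      hS.isMinimalSet_closure_regularPart, hS.almostAutomorphicOn, hS.not_isFilledIn⟩
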